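/- Theorem 2.1. For $x\in\mathbb{C}$ put $e(x)=e^{2\pi i x}$, and for $\tau\in\mathbb{C}$ with $\operatorname{Im}\tau>0$ let $$\theta_\tau(\upsilon)=\frac1i\sum_{m\in\mathbb{Z}}(-1)^m e^{\pi i\tau(m+\frac12)^2}\,e\!\left(\tfrac{(2m+1)\upsilon}{2}\right),\qquad \Delta_\tau(a,b)=\frac{\theta_\tau'(0)\,\theta_\tau(a+b)}{\theta_\tau(a)\,\theta_\tau(b)} .$$ Since $\Delta_\tau$ is $1$-periodic in each variable, there is a function $\delta=\delta_\tau$ on $\mathbb{C}^*\times\mathbb{C}^*$ with $\delta_\tau(e(a),e(b))=\frac{1}{2\pi i}\Delta_\tau(a,b)$. Let $n>0$ be a natural number. Then $$A_n(t_1,t_2,\mu_1,\mu_2)=\sum_{k=1}^{n}\delta\!\left(\frac{t_1^{n-k+1}}{t_2^{k-1}},\mu_1^{k}\mu_2^{n-k}\right)\delta\!\left(\frac{t_2^{k}}{t_1^{n-k}},\mu_1^{k-1}\mu_2^{n-k+1}\right)$$ and $$B_n(t_1,t_2,\mu_1,\mu_2)=\frac1n\sum_{k=0}^{n-1}\sum_{\ell=0}^{n-1}\left(\frac{\mu_2}{\mu_1}\right)^{\ell}\delta\!\left(e\!\left(\tfrac{k-\ell\tau}{n}\right)t_1,\mu_1^n\right)\delta\!\left(e\!\left(\tfrac{\tau\ell-k}{n}\right)t_2,\mu_2^n\right)$$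 are meromorphic functions of $(t_1,t_2,\mu_1,\mu_2,\tau)\in(\mathbb{C}^*)^4\times\{\operatorname{Im}\tau>0\}$, and they are equal: the set of points at which the denominators of all the summands of $A_n$ and $B_n$ are nonzero is dense, and $A_n=B_n$ at every such point. In particular (specializing to $t_1=t_2^{-1}=e(x)$, $\mu_1=\mu_2=e(z/n)$), $$n\,\Delta_\tau(nx,z)\,\Delta_\tau(-nx,z)=\frac1n\sum_{k,\ell=0}^{n-1}\Delta_\tau\!\left(\tfrac{k-\ell\tau}{n}+x,z\right)\Delta_\tau\!\left(\tfrac{\tau\ell-k}{n}-x,z\right)$$ for all $x,z,\tau\in\mathbb{C}$ with $\operatorname{Im}\tau>0$ for which all the denominators are nonzero. -/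

import Mathlib

open Complex

namespace CyclicTheta

noncomputable section

/-- `e(x) = exp(2πi x)`. -/
def e (x : ℂ) : ℂ := exp (2 * (Real.pi : ℂ) * I * x)

/-- The Jacobi theta function
`θ_τ(υ) = (1/i) ∑_{n ∈ ℤ} (-1)^n q₀^((n+1/2)^2) e((2n+1)υ/2)`, where `q₀^s` means `exp(πi τ s)`.
For `im τ > 0` the series converges absolutely. -/
def theta (τ υ : ℂ) : ℂ :=
  (1 / I) * ∑' n : ℤ, (-1 : ℂ) ^ n * exp ((Real.pi : ℂ) * I * τ * ((n : ℂ) + 1 / 2) ^ 2)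
    * e ((2 * (n : ℂ) + 1) * υ / 2)

/-- `Δ_τ(a,b) = θ_τ'(0) θ_τ(a+b) / (θ_τ(a) θ_τ(b))`, in additive variables. -/
def Delta (τ a b : ℂ) : ℂ :=
  deriv (theta τ) 0 * theta τ (a + b) / (theta τ a * theta τ b)

/-- The additive logarithm `log A / (2πi)` (principal value), so that `e (lg A) = A` for `A ≠ 0`. -/
def lg (A : ℂ) : ℂ := log A / (2 * (Real.pi : ℂ) * I)

/-- The function `Δ_τ` in multiplicative variables: `δ(e(a), e(b)) = Δ(a,b) / (2πi)`.
That the choice of the logarithms is irrelevant is proved in `delta_e` below. -/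
def delta (τ A B : ℂ) : ℂ := Delta τ (lg A) (lg B) / (2 * (Real.pi : ℂ) * I)

/-- The denominator of `Δ_τ(a,b)` does not vanish. -/
def DeltaDefined (τ a b : ℂ) : Prop := theta τ a ≠ 0 ∧ theta τ b ≠ 0

/-- `(A,B)` lies in `ℂˣ × ℂˣ` and the denominator of `δ(A,B)` does not vanish there. -/
def deltaDefined (τ A B : ℂ) : Prop := A ≠ 0 ∧ B ≠ 0 ∧ DeltaDefined τ (lg A) (lg B)

/-- The sum over the `n` fixed points of the minimal resolution of `ℂ²/ℤ_n`. -/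
def A (n : ℕ) (t₁ t₂ μ₁ μ₂ τ : ℂ) : ℂ :=
  ∑ k ∈ Finset.Icc 1 n,
    delta τ (t₁ ^ (n - k + 1) / t₂ ^ (k - 1)) (μ₁ ^ k * μ₂ ^ (n - k))
      * delta τ (t₂ ^ k / t₁ ^ (n - k)) (μ₁ ^ (k - 1) * μ₂ ^ (n - k + 1))

/-- The weighted sum over the `n`-torsion points of the elliptic curve `ℂ/(ℤ + τℤ)`. -/
def B (n : ℕ) (t₁ t₂ μ₁ μ₂ τ : ℂ) : ℂ :=
  1 / (n : ℂ) * ∑ k ∈ Finset.range n, ∑ l ∈ Finset.range n,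
    (μ₂ / μ₁) ^ l
      * delta τ (e (((k : ℂ) - (l : ℂ) * τ) / (n : ℂ)) * t₁) (μ₁ ^ n)
      * delta τ (e ((τ * (l : ℂ) - (k : ℂ)) / (n : ℂ)) * t₂) (μ₂ ^ n)

/-- The domain `(ℂˣ)⁴ × {im τ > 0}` of the variables `(t₁, t₂, μ₁, μ₂, τ)`. -/
def domain : Set (ℂ × ℂ × ℂ × ℂ × ℂ) :=
  {p | p.1 ≠ 0 ∧ p.2.1 ≠ 0 ∧ p.2.2.1 ≠ 0 ∧ p.2.2.2.1 ≠ 0 ∧ 0 < p.2.2.2.2.im}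

/-- A function of the five variables `(t₁, t₂, μ₁, μ₂, τ)` as a function on `ℂ⁵`. -/
def tupled (f : ℂ → ℂ → ℂ → ℂ → ℂ → ℂ) (p : ℂ × ℂ × ℂ × ℂ × ℂ) : ℂ :=
  f p.1 p.2.1 p.2.2.1 p.2.2.2.1 p.2.2.2.2

/-- All the summands of `A n` are defined at the point. -/
def ADefined (n : ℕ) (t₁ t₂ μ₁ μ₂ τ : ℂ) : Prop :=
  ∀ k ∈ Finset.Icc 1 n,
    deltaDefined τ (t₁ ^ (n - k + 1) / t₂ ^ (k - 1)) (μ₁ ^ k * μ₂ ^ (n - k))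
      ∧ deltaDefined τ (t₂ ^ k / t₁ ^ (n - k)) (μ₁ ^ (k - 1) * μ₂ ^ (n - k + 1))

/-- All the summands of `B n` are defined at the point. -/
def BDefined (n : ℕ) (t₁ t₂ μ₁ μ₂ τ : ℂ) : Prop :=
  ∀ k ∈ Finset.range n, ∀ l ∈ Finset.range n,
    deltaDefined τ (e (((k : ℂ) - (l : ℂ) * τ) / (n : ℂ)) * t₁) (μ₁ ^ n)
      ∧ deltaDefined τ (e ((τ * (l : ℂ) - (k : ℂ)) / (n : ℂ)) * t₂) (μ₂ ^ n)

/-- `f` is (a representative of) a meromorphic function on the set `U`: near each point of `U` it is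
a quotient `g / h` of holomorphic functions off the zeros of `h`, where `h` does not vanish
identically on any non-empty open set. The values of `f` at the zeros of `h` are irrelevant. -/
def IsMeromorphicOn {E : Type*} [NormedAddCommGroup E] [NormedSpace ℂ E]
    (f : E → ℂ) (U : Set E) : Prop :=
  ∀ p ∈ U, ∃ V : Set E, IsOpen V ∧ p ∈ V ∧ V ⊆ U ∧ ∃ g h : E → ℂ,
    DifferentiableOn ℂ g V ∧ DifferentiableOn ℂ h V ∧ V ⊆ closure {x ∈ V | h x ≠ 0} ∧
      ∀ x ∈ V, h x ≠ 0 → f x = g x / h x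

theorem e_add (x y : ℂ) : e (x + y) = e x * e y := by
  simp only [e, mul_add, exp_add]

theorem e_lg {x : ℂ} (hx : x ≠ 0) : e (lg x) = x := by
  have h : (2 * (Real.pi : ℂ) * I) ≠ 0 := two_pi_I_ne_zero
  rw [e, lg, mul_div_cancel₀ _ h, exp_log hx]

theorem theta_add_one (τ υ : ℂ) : theta τ (υ + 1) = -theta τ υ := by
  have key : ∀ n : ℤ, e ((2 * (n : ℂ) + 1) * (υ + 1) / 2) = -e ((2 * (n : ℂ) + 1) * υ / 2) := by
    intro n
    have h1 : (2 * (n : ℂ) + 1) * (υ + 1) / 2 = (2 * (n : ℂ) + 1) * υ / 2 + ((n : ℂ) + 1 / 2) := by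
      ring
    have h2 : e ((n : ℂ) + 1 / 2) = -1 := by
      have h3 : 2 * (Real.pi : ℂ) * I * ((n : ℂ) + 1 / 2)
          = (n : ℂ) * (2 * (Real.pi : ℂ) * I) + (Real.pi : ℂ) * I := by ring
      rw [e, h3, exp_add, exp_int_mul_two_pi_mul_I, exp_pi_mul_I, one_mul]
    rw [h1, e_add, h2, mul_neg_one]
  simp only [theta, key, mul_neg, tsum_neg]

theorem Delta_comm (τ a b : ℂ) : Delta τ a b = Delta τ b a := by
  simp only [Delta, add_comm a b, mul_comm (theta τ a)]

theorem Delta_add_one (τ a b : ℂ) : Delta τ (a + 1) b = Delta τ a b := by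
  have h : a + 1 + b = a + b + 1 := by ring
  simp only [Delta, h, theta_add_one, mul_neg, neg_mul, neg_div_neg_eq]

theorem Delta_add_int (τ a b : ℂ) (m : ℤ) : Delta τ (a + m) b = Delta τ a b := by
  induction m with
  | zero => simp
  | succ i ih =>
    rw [← ih, ← Delta_add_one τ (a + ((i : ℤ) : ℂ)) b]
    congr 1
    push_cast
    ring
  | pred i ih =>
    rw [← ih, ← Delta_add_one τ (a + ((-(i : ℤ) - 1 : ℤ) : ℂ)) b]
    congr 1
    push_cast
    ring

theorem lg_e (a : ℂ) : ∃ m : ℤ, lg (e a) = a + m := by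
  have h : (2 * (Real.pi : ℂ) * I) ≠ 0 := two_pi_I_ne_zero
  have h1 : exp (2 * (Real.pi : ℂ) * I * lg (e a)) = exp (2 * (Real.pi : ℂ) * I * a) :=
    e_lg (x := e a) (exp_ne_zero _)
  obtain ⟨m, hm⟩ := exp_eq_exp_iff_exists_int.1 h1
  refine ⟨m, mul_left_cancel₀ h ?_⟩
  rw [hm]
  ring

/-- `δ` does not depend on the choice of the logarithms. -/
theorem delta_e (τ a b : ℂ) : delta τ (e a) (e b) = Delta τ a b / (2 * (Real.pi : ℂ) * I) := by
  obtain ⟨m, hm⟩ := lg_e a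
  obtain ⟨k, hk⟩ := lg_e b
  rw [delta, hm, hk, Delta_add_int, Delta_comm, Delta_add_int, Delta_comm]

end

end CyclicTheta

namespace CyclicTheta

open Filter Topology

/-! Write `t₁ = e(a₁)`, `t₂ = e(a₂)`, `μ₁ = e(b₁)`, `μ₂ = e(b₂)`. Up to the factor `(2πi)⁻²`, both
sums equal `Δ(a₁+a₂, n b₂) Δ(n a₁, b₁-b₂) - Δ(a₁+a₂, n b₁) Δ(-n a₂, b₁-b₂)`. The tool for both is
Fay's identity `Delta_mul_Delta`, which splits `Δ(x,c) Δ(y,d)` into two products involving only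
`x+y` and `c-d` besides the original arguments. In `A n` the values of `x+y` and `c-d` are the same
for all summands, and the sum telescopes (`addA_eq`). In `B n` the torsion shifts cancel in `x+y`,
and what remains is a weighted sum of a single `Δ` over torsion points (`addB_eq`), evaluated by the
multiplication formula `sum_Delta_torsion`.

Fay's identity is the three-term relation of theta functions, that is, the Plücker relation for the
rank-two alternating form `θ(x+y) θ(x-y)`. The multiplication formula comes from Kronecker's series
`∑ e(a)^m / (1 - q^m e(b))` with `q = e(τ)` (`hasSum_Delta`): summing over `k` selects the exponents
divisible by `n`, and summing over `l` is a geometric sum. This works for `a` in a strip; the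
identity theorem gives the rest.

The common value has denominators that `A n` and `B n` lack; they are avoided by a small
perturbation and continuity (`addA_eq_addB`). The specialization lies on this degenerate locus.
Meromorphy and density are tested along a one-parameter flow on which every denominator is a theta
function of a nonconstant linear argument. -/

/-! ### The theta series: convergence, holomorphy, parity and quasi-periodicity. -/

/-- The summand of the theta series. -/
noncomputable def thetaTerm (τ : ℂ) (n : ℤ) (v : ℂ) : ℂ :=
  (-1 : ℂ) ^ n * exp ((Real.pi : ℂ) * I * τ * ((n : ℂ) + 1 / 2) ^ 2)
    * e ((2 * (n : ℂ) + 1) * v / 2)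

theorem theta_eq_tsum (τ v : ℂ) : theta τ v = (1 / I) * ∑' n : ℤ, thetaTerm τ n v := rfl

theorem e_zero : e 0 = 1 := by simp [e]

theorem e_ne_zero (x : ℂ) : e x ≠ 0 := exp_ne_zero _

theorem e_neg (x : ℂ) : e (-x) = (e x)⁻¹ := by simp [e, exp_neg]

theorem e_sub (x y : ℂ) : e (x - y) = e x / e y := by
  rw [sub_eq_add_neg, e_add, e_neg, div_eq_mul_inv]

theorem e_intCast (n : ℤ) : e n = 1 := by
  rw [e, mul_comm, exp_int_mul_two_pi_mul_I]

theorem e_int_mul (n : ℤ) (x : ℂ) : e (n * x) = e x ^ n := by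
  rw [e, e, ← exp_int_mul]
  ring_nf

theorem e_nat_mul (n : ℕ) (x : ℂ) : e (n * x) = e x ^ n := by
  have := e_int_mul n x
  simpa using this

theorem norm_e (x : ℂ) : ‖e x‖ = Real.exp (-(2 * Real.pi * x.im)) := by
  rw [e, Complex.norm_exp]
  congr 1
  simp

theorem norm_e_lt_one {x : ℂ} (hx : 0 < x.im) : ‖e x‖ < 1 := by
  rw [norm_e, Real.exp_lt_one_iff]
  have := Real.pi_pos
  nlinarith [mul_pos this hx]

theorem neg_one_zpow_eq_exp (n : ℤ) : (-1 : ℂ) ^ n = exp (n * ((Real.pi : ℂ) * I)) := by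
  rw [exp_int_mul, exp_pi_mul_I]

theorem thetaTerm_eq_exp (τ : ℂ) (n : ℤ) (v : ℂ) :
    thetaTerm τ n v = exp (n * ((Real.pi : ℂ) * I) + (Real.pi : ℂ) * I * τ * ((n : ℂ) + 1 / 2) ^ 2
      + 2 * (Real.pi : ℂ) * I * ((2 * (n : ℂ) + 1) * v / 2)) := by
  rw [thetaTerm, e, neg_one_zpow_eq_exp, exp_add, exp_add]

/-- The sign `(-1)^n` and the cross term of `(n + 1/2)²` are absorbed by shifting the argument by
`(1 + τ)/2`. Convergence and holomorphy are then inherited from `jacobiTheta₂`. -/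
theorem thetaTerm_eq_jacobi (τ : ℂ) (n : ℤ) (v : ℂ) :
    thetaTerm τ n v = exp ((Real.pi : ℂ) * I * τ / 4) * e (v / 2)
      * jacobiTheta₂_term n (v + (1 + τ) / 2) τ := by
  rw [thetaTerm_eq_exp, jacobiTheta₂_term, e, ← exp_add, ← exp_add]
  congr 1
  ring

theorem theta_eq_jacobi (τ v : ℂ) :
    theta τ v = (1 / I) * (exp ((Real.pi : ℂ) * I * τ / 4) * e (v / 2)
      * jacobiTheta₂ (v + (1 + τ) / 2) τ) := by
  simp only [theta_eq_tsum, thetaTerm_eq_jacobi, tsum_mul_left, jacobiTheta₂]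

theorem summable_thetaTerm {τ : ℂ} (hτ : 0 < τ.im) (v : ℂ) :
    Summable fun n : ℤ => thetaTerm τ n v := by
  simp only [thetaTerm_eq_jacobi]
  exact ((summable_jacobiTheta₂_term_iff _ τ).2 hτ).mul_left _

theorem differentiable_e : Differentiable ℂ e := by
  unfold e
  fun_prop

theorem differentiableAt_theta_prod {τ : ℂ} (hτ : 0 < τ.im) (v : ℂ) :
    DifferentiableAt ℂ (fun p : ℂ × ℂ => theta p.1 p.2) (τ, v) := by
  have h1 : DifferentiableAt ℂ (fun p : ℂ × ℂ => jacobiTheta₂ (p.2 + (1 + p.1) / 2) p.1) (τ, v) :=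
    ((hasFDerivAt_jacobiTheta₂ (v + (1 + τ) / 2) hτ).differentiableAt).comp (τ, v)
      (f := fun p : ℂ × ℂ => (p.2 + (1 + p.1) / 2, p.1)) (by fun_prop)
  have h2 : DifferentiableAt ℂ (fun p : ℂ × ℂ => e (p.2 / 2)) (τ, v) := by
    unfold e
    fun_prop
  simp only [theta_eq_jacobi]
  exact ((DifferentiableAt.mul (by fun_prop) h2).mul h1).const_mul _

theorem differentiable_theta {τ : ℂ} (hτ : 0 < τ.im) : Differentiable ℂ (theta τ) := fun v =>
  (differentiableAt_theta_prod hτ v).comp v (f := fun v : ℂ => (τ, v)) (by fun_prop)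

theorem theta_neg (τ v : ℂ) : theta τ (-v) = -theta τ v := by
  rw [theta_eq_tsum, theta_eq_tsum, ← mul_neg, ← tsum_neg,
    ← (Equiv.subLeft (-1 : ℤ)).tsum_eq]
  congr 1
  refine tsum_congr fun n => ?_
  have h : (-1 : ℂ) ^ (-1 - n) = -(-1) ^ n := by
    rcases Int.even_or_odd n with h | h
    · rw [h.neg_one_zpow, Odd.neg_one_zpow]
      exact Odd.sub_even (by decide) h
    · rw [h.neg_one_zpow, Even.neg_one_zpow, neg_neg]
      exact Odd.sub_odd (by decide) h
  simp only [thetaTerm, Equiv.subLeft_apply, h]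
  push_cast
  ring_nf

theorem theta_zero (τ : ℂ) : theta τ 0 = 0 := by
  have h := theta_neg τ 0
  rw [neg_zero] at h
  exact self_eq_neg.1 h

theorem theta_add_tau (τ v : ℂ) : theta τ (v + τ) = -e (-(τ / 2) - v) * theta τ v := by
  rw [theta_eq_tsum, theta_eq_tsum, mul_left_comm]
  congr 1
  rw [← tsum_mul_left,
    ← (Equiv.addRight (1 : ℤ)).tsum_eq (fun n => -e (-(τ / 2) - v) * thetaTerm τ n v)]
  refine tsum_congr fun n => ?_
  -- The logarithm `-πi` of `-1` makes the two exponents agree exactly after the shift `n ↦ n + 1`,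
  -- with no multiple of `2πi` left over.
  have h : (-1 : ℂ) = exp (-((Real.pi : ℂ) * I)) := by
    rw [exp_neg, exp_pi_mul_I]; norm_num
  rw [Equiv.coe_addRight, thetaTerm_eq_exp, thetaTerm_eq_exp, neg_eq_neg_one_mul, h, e, ← exp_add,
    ← exp_add]
  congr 1
  push_cast
  ring

/-- Integer translations only change the sign of `θ`, so its vanishing is independent of the branch
of the logarithm. -/
theorem theta_eq_zero_iff_of_e_eq {τ v w : ℂ} (h : e v = e w) :
    theta τ v = 0 ↔ theta τ w = 0 := by
  have h1 (v : ℂ) (m : ℤ) : theta τ (v + m) = 0 ↔ theta τ v = 0 := by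
    induction m with
    | zero => simp
    | succ i ih =>
      rw [← ih]
      push_cast
      rw [← add_assoc, theta_add_one, neg_eq_zero]
    | pred i ih =>
      rw [← ih, ← neg_eq_zero, ← theta_add_one]
      push_cast
      ring_nf
  obtain ⟨m, hm⟩ := exp_eq_exp_iff_exists_int.1 h
  have : v = w + m := by
    apply mul_left_cancel₀ two_pi_I_ne_zero
    rw [hm]
    ring
  rw [this, h1]

theorem hasDerivAt_theta_zero {τ : ℂ} (hτ : 0 < τ.im) :
    HasDerivAt (theta τ) (deriv (theta τ) 0) 0 :=
  (differentiable_theta hτ 0).hasDerivAt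

/-! ### The three-term relation and Fay's identity. -/

/-- Pairs of integers, split by the parity of their sum. -/
def parityEquiv : (ℤ × ℤ) ⊕ (ℤ × ℤ) ≃ ℤ × ℤ where
  toFun := Sum.elim (fun p => (p.1 + p.2, p.1 - p.2)) (fun p => (p.1 + p.2, p.1 - p.2 - 1))
  invFun p := if (p.1 + p.2) % 2 = 0 then Sum.inl ((p.1 + p.2) / 2, (p.1 - p.2) / 2)
    else Sum.inr ((p.1 + p.2 + 1) / 2, (p.1 - p.2 - 1) / 2)
  left_inv := by
    rintro (⟨j, l⟩ | ⟨j, l⟩)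
    · refine (if_pos (show (j + l + (j - l)) % 2 = 0 by omega)).trans (congrArg Sum.inl ?_)
      refine Prod.ext (show (j + l + (j - l)) / 2 = j by omega)
        (show (j + l - (j - l)) / 2 = l by omega)
    · refine (if_neg (show ¬ (j + l + (j - l - 1)) % 2 = 0 by omega)).trans (congrArg Sum.inr ?_)
      refine Prod.ext (show (j + l + (j - l - 1) + 1) / 2 = j by omega)
        (show (j + l - (j - l - 1) - 1) / 2 = l by omega)
  right_inv := by
    rintro ⟨m, n⟩
    by_cases h : (m + n) % 2 = 0
    · simp only [h, if_true, Sum.elim_inl, Prod.mk.injEq]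
      omega
    · simp only [h, if_false, Sum.elim_inr, Prod.mk.injEq]
      omega

/-- The product `θ(x+y) θ(x-y)` is an alternating form of rank two. -/
theorem exists_theta_mul_theta {τ : ℂ} (hτ : 0 < τ.im) : ∃ f g : ℂ → ℂ,
    ∀ x y, theta τ (x + y) * theta τ (x - y) = f x * g y - g x * f y := by
  have hτ2 : 0 < (2 * τ).im := by simpa using hτ
  -- For indices `m = j+l`, `n = j-l` the quadratic form becomes `2l² + (2j² + 2j + 1/2)` and the
  -- linear form `(2j+1)x + 2ly`, so the term separates into a series in `2τ` and its half-period
  -- shift. Odd `m+n` exchanges the two roles.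
  let F : ℂ → ℤ → ℂ := fun x j => jacobiTheta₂_term j (2 * x) (2 * τ)
  let G : ℂ → ℤ → ℂ := fun x j =>
    exp ((Real.pi : ℂ) * I * τ / 2 + 2 * (Real.pi : ℂ) * I * x)
      * jacobiTheta₂_term j (2 * x + τ) (2 * τ)
  have hF : ∀ x, Summable fun j => ‖F x j‖ := fun x =>
    ((summable_jacobiTheta₂_term_iff _ _).2 hτ2).norm
  have hG : ∀ x, Summable fun j => ‖G x j‖ := fun x =>
    (((summable_jacobiTheta₂_term_iff _ _).2 hτ2).mul_left _).norm
  refine ⟨fun x => ∑' j, F x j, fun x => ∑' j, G x j, fun x y => ?_⟩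
  have h1 := summable_mul_of_summable_norm (summable_thetaTerm hτ (x + y)).norm
    (summable_thetaTerm hτ (x - y)).norm
  have key1 : ∀ p : ℤ × ℤ, thetaTerm τ (p.1 + p.2) (x + y) * thetaTerm τ (p.1 - p.2) (x - y)
      = G x p.1 * F y p.2 := by
    rintro ⟨j, l⟩
    -- The signs `(-1)^(j+l)` and `(-1)^(j-l)` contribute `2πi j` to the exponent; this factor
    -- removes it.
    have : exp (-(2 * (j : ℂ) * ((Real.pi : ℂ) * I))) = 1 := by
      have := exp_int_mul_two_pi_mul_I (-j)
      rw [← this]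
      push_cast
      ring_nf
    refine (one_mul _).symm.trans ((congrArg (· * _) this.symm).trans ?_)
    rw [thetaTerm_eq_exp, thetaTerm_eq_exp]
    simp only [F, G, jacobiTheta₂_term, ← exp_add]
    congr 1
    push_cast
    ring
  have key2 : ∀ p : ℤ × ℤ, thetaTerm τ (p.1 + p.2) (x + y) * thetaTerm τ (p.1 - p.2 - 1) (x - y)
      = -(F x p.1 * G y p.2) := by
    rintro ⟨j, l⟩
    have : exp (-((2 * (j : ℂ) - 1) * ((Real.pi : ℂ) * I))) = -1 := by
      have h := exp_int_mul_two_pi_mul_I (-j)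
      have : -((2 * (j : ℂ) - 1) * ((Real.pi : ℂ) * I))
        = ((-j : ℤ) : ℂ) * (2 * (Real.pi : ℂ) * I) + (Real.pi : ℂ) * I := by push_cast; ring
      rw [this, exp_add, h, exp_pi_mul_I, one_mul]
    rw [← neg_inj, neg_neg, neg_eq_neg_one_mul]
    refine (congrArg (· * _) this.symm).trans ?_
    rw [thetaTerm_eq_exp, thetaTerm_eq_exp]
    simp only [F, G, jacobiTheta₂_term, ← exp_add]
    congr 1
    push_cast
    ring
  rw [theta_eq_tsum, theta_eq_tsum, mul_mul_mul_comm,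
    tsum_mul_tsum_of_summable_norm (summable_thetaTerm hτ (x + y)).norm
      (summable_thetaTerm hτ (x - y)).norm, ← parityEquiv.tsum_eq]
  have h2 := parityEquiv.summable_iff.2 h1
  rw [Summable.tsum_sum]
  · simp only [parityEquiv, Equiv.coe_fn_mk, Sum.elim_inl, Sum.elim_inr, key1, key2, tsum_neg]
    rw [← tsum_mul_tsum_of_summable_norm (hF x) (hG y),
      ← tsum_mul_tsum_of_summable_norm (hG x) (hF y)]
    have : (1 / I) * (1 / I) = -1 := by simp
    rw [this]
    ring
  · exact h2.comp_injective Sum.inl_injective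
  · exact h2.comp_injective Sum.inr_injective

/-- The three-term relation of Weierstrass, in the form used for the addition formula. -/
theorem theta_three_term {τ : ℂ} (hτ : 0 < τ.im) (x y c d : ℂ) :
    theta τ (x + c) * theta τ (y + d) * (theta τ (x + y) * theta τ (c - d))
      = theta τ (x + y + d) * theta τ (x + (c - d)) * (theta τ c * theta τ y)
        - theta τ (x + y + c) * theta τ (y + (d - c)) * (theta τ x * theta τ d) := by
  obtain ⟨f, g, h⟩ := exists_theta_mul_theta hτ
  -- With these half-sums, the twelve theta values pair up, up to sign, into `[UV] = θ(U+V) θ(U-V)`,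
  -- and the claim is the Plücker relation `[XY][ZW] = [XZ][YW] - [XW][YZ]`.
  obtain ⟨X, hX⟩ : ∃ X, X = (x + y + c + d) / 2 := ⟨_, rfl⟩
  obtain ⟨Y, hY⟩ : ∃ Y, Y = (x - y + c - d) / 2 := ⟨_, rfl⟩
  obtain ⟨Z, hZ⟩ : ∃ Z, Z = (x + y + c - d) / 2 := ⟨_, rfl⟩
  obtain ⟨W, hW⟩ : ∃ W, W = (x + y - c + d) / 2 := ⟨_, rfl⟩
  have e1 : x + c = X + Y := by rw [hX, hY]; ring
  have e2 : y + d = X - Y := by rw [hX, hY]; ring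
  have e3 : x + y = Z + W := by rw [hZ, hW]; ring
  have e4 : c - d = Z - W := by rw [hZ, hW]; ring
  have e5 : x + y + d = X + W := by rw [hX, hW]; ring
  have e6 : x + (c - d) = Y + Z := by rw [hY, hZ]; ring
  have e7 : c = X - W := by rw [hX, hW]; ring
  have e8 : theta τ y = -theta τ (Y - Z) := by rw [← theta_neg, hY, hZ]; ring_nf
  have e9 : x + y + c = X + Z := by rw [hX, hZ]; ring
  have e10 : theta τ (y + (d - c)) = -theta τ (Y - W) := by rw [← theta_neg, hY, hW]; ring_nf
  have e11 : x = Y + W := by rw [hY, hW]; ring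
  have e12 : d = X - Z := by rw [hX, hZ]; ring
  rw [e10, e8, e9, e5, e6, e1, e2, e3, e4, congrArg (theta τ) e7, congrArg (theta τ) e11,
    congrArg (theta τ) e12]
  clear e1 e2 e3 e4 e5 e6 e7 e8 e9 e10 e11 e12 hX hY hZ hW
  linear_combination (theta τ (Z + W) * theta τ (Z - W)) * h X Y
    + (f X * g Y - g X * f Y) * h Z W - (theta τ (Y + W) * theta τ (Y - W)) * h X Z
    - (f X * g Z - g X * f Z) * h Y W + (theta τ (Y + Z) * theta τ (Y - Z)) * h X W
    + (f X * g W - g X * f W) * h Y Z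

/-- Fay's identity for the Kronecker function. -/
theorem Delta_mul_Delta {τ x y c d : ℂ} (hτ : 0 < τ.im) (hx : theta τ x ≠ 0) (hy : theta τ y ≠ 0)
    (hc : theta τ c ≠ 0) (hd : theta τ d ≠ 0) (hxy : theta τ (x + y) ≠ 0)
    (hcd : theta τ (c - d) ≠ 0) :
    Delta τ x c * Delta τ y d
      = Delta τ (x + y) d * Delta τ x (c - d) + Delta τ (x + y) c * Delta τ y (d - c) := by
  have h := theta_three_term hτ x y c d
  have hdc : theta τ (d - c) = -theta τ (c - d) := by rw [← theta_neg, neg_sub]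
  simp only [Delta]
  rw [hdc]
  field_simp
  linear_combination (deriv (theta τ) 0)^2 * h

theorem Delta_neg_neg (τ a b : ℂ) : Delta τ (-a) (-b) = -Delta τ a b := by
  rw [Delta, Delta, ← neg_add, theta_neg, theta_neg, theta_neg]
  ring

/-! ### Nonvanishing of theta and isolated zeros. -/

/-- The theta function does not vanish identically: its lowest Fourier coefficient is nonzero. -/
theorem exists_theta_ne_zero {τ : ℂ} (hτ : 0 < τ.im) : ∃ v, theta τ v ≠ 0 := by
  by_contra! h
  have hI : (1 / I : ℂ) ≠ 0 := by simp
  -- The factor `e(-x/2)` turns the half-integral frequencies into integers, so integrating over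
  -- `[0, 1]` isolates the term `n = 0`.
  have h0 : ∀ x : ℝ, HasSum (fun n : ℤ => thetaTerm τ n x * e (-(x / 2))) 0 := fun x => by
    have h1 := (summable_thetaTerm hτ x).hasSum
    have h2 := h x
    rw [theta_eq_tsum, mul_eq_zero, or_iff_right hI] at h2
    rw [h2] at h1
    simpa using h1.mul_right (e (-(x / 2)))
  have hterm : ∀ (n : ℤ) (x : ℝ), thetaTerm τ n x * e (-(x / 2))
      = thetaTerm τ n 0 * exp ((2 * (Real.pi : ℂ) * I * n) * x) := fun n x => by
    rw [thetaTerm, thetaTerm, mul_zero, zero_div, e_zero, mul_one, mul_assoc, ← e_add, e]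
    ring_nf
  have hnorm : ∀ (n : ℤ) (x : ℝ), ‖thetaTerm τ n x * e (-(x / 2))‖ ≤ ‖thetaTerm τ n 0‖ := by
    intro n x
    have : 2 * (Real.pi : ℂ) * I * n * x = ((2 * Real.pi * n * x : ℝ) : ℂ) * I := by
      push_cast; ring
    rw [hterm, norm_mul, this, Complex.norm_exp_ofReal_mul_I, mul_one]
  have hint := intervalIntegral.hasSum_integral_of_dominated_convergence
    (μ := MeasureTheory.volume) (a := (0 : ℝ)) (b := 1)
    (F := fun (n : ℤ) (x : ℝ) => thetaTerm τ n x * e (-(x / 2))) (f := fun _ => (0 : ℂ))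
    (fun n _ => ‖thetaTerm τ n 0‖)
    (fun n => by
      simp only [hterm]
      exact Continuous.aestronglyMeasurable (by fun_prop))
    (fun n => MeasureTheory.ae_of_all _ fun x _ => hnorm n x)
    (MeasureTheory.ae_of_all _ fun x _ => (summable_thetaTerm hτ 0).norm)
    (by simp) (MeasureTheory.ae_of_all _ fun x _ => h0 x)
  have hval : ∀ n : ℤ, n ≠ 0 → ∫ x : ℝ in (0 : ℝ)..1, thetaTerm τ n x * e (-(x / 2)) = 0 := by
    intro n hn
    simp only [hterm]
    rw [intervalIntegral.integral_const_mul, integral_exp_mul_complex]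
    · have := exp_int_mul_two_pi_mul_I n
      rw [mul_comm] at this
      simp [this]
    · exact mul_ne_zero two_pi_I_ne_zero (by exact_mod_cast hn)
  have h1 := hint.unique (hasSum_single 0 hval)
  simp only [hterm] at h1
  simp [thetaTerm, e_ne_zero] at h1

/-- The zeros of a nonconstant linear pullback of the theta function are isolated. -/
theorem eventually_theta_ne_zero {τ : ℂ} (hτ : 0 < τ.im) (a : ℂ) {c : ℂ} (hc : c ≠ 0) :
    ∀ᶠ s in 𝓝[≠] (0 : ℂ), theta τ (a + c * s) ≠ 0 := by
  have hd : Differentiable ℂ fun s : ℂ => theta τ (a + c * s) :=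
    (differentiable_theta hτ).comp (by fun_prop)
  have ha : AnalyticOnNhd ℂ (fun s : ℂ => theta τ (a + c * s)) Set.univ := fun s _ =>
    hd.analyticAt s
  by_contra hf
  have h1 := ha.eqOn_zero_of_preconnected_of_frequently_eq_zero isPreconnected_univ
    (Set.mem_univ 0) ((Filter.not_eventually.1 hf).mono fun _ hs => not_not.1 hs)
  obtain ⟨v, hv⟩ := exists_theta_ne_zero hτ
  apply hv
  have := h1 (Set.mem_univ ((v - a) / c))
  simp only [Pi.zero_apply] at this
  rwa [mul_div_cancel₀ _ hc, add_sub_cancel] at this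

/-! ### Kronecker's series for `Δ`. -/

/-- The partial theta series `∑_{i ≥ 0} (-1)^i q^(i(i-1)/2) z^i`. -/
noncomputable def partialTheta (q z : ℂ) : ℂ := ∑' i : ℕ, (-1) ^ i * q ^ (i.choose 2) * z ^ i

theorem summable_pow_choose_two {r : ℝ} (h0 : 0 ≤ r) (h1 : r < 1) :
    Summable fun i : ℕ => r ^ (i.choose 2) := by
  rw [← summable_nat_add_iff 1]
  refine Summable.of_nonneg_of_le (fun i => by positivity) (fun i => ?_)
    (summable_geometric_of_lt_one h0 h1)
  refine pow_le_pow_of_le_one h0 h1.le ?_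
  rw [Nat.choose_succ_succ' i 1, Nat.choose_one_right]
  omega

theorem norm_partialTheta_term_le {q z : ℂ} (hz : ‖z‖ ≤ 1) (i : ℕ) :
    ‖(-1) ^ i * q ^ (i.choose 2) * z ^ i‖ ≤ ‖q‖ ^ (i.choose 2) := by
  simp only [norm_mul, norm_pow, norm_neg, norm_one, one_pow, one_mul]
  exact mul_le_of_le_one_right (by positivity) (pow_le_one₀ (norm_nonneg _) hz)

theorem norm_partialTheta_le {q z : ℂ} (hq : ‖q‖ < 1) (hz : ‖z‖ ≤ 1) :
    ‖partialTheta q z‖ ≤ ∑' i : ℕ, ‖q‖ ^ (i.choose 2) :=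
  tsum_of_norm_bounded (summable_pow_choose_two (norm_nonneg _) hq).hasSum
    (norm_partialTheta_term_le hz)

theorem partialTheta_eq {q z : ℂ} (hq : ‖q‖ < 1) (hz : ‖z‖ ≤ 1) :
    partialTheta q z = 1 - z * partialTheta q (q * z) := by
  have hs : Summable fun i : ℕ => (-1) ^ i * q ^ (i.choose 2) * z ^ i :=
    (summable_pow_choose_two (norm_nonneg _) hq).of_norm_bounded (norm_partialTheta_term_le hz)
  rw [partialTheta, hs.tsum_eq_zero_add, partialTheta, ← tsum_mul_left, sub_eq_add_neg,
    ← tsum_neg]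
  congr 1
  · simp
  · refine tsum_congr fun i => ?_
    rw [Nat.choose_succ_succ' i 1, Nat.choose_one_right]
    ring

/-- The coefficients of the expansion of `θ / (1 - e)`, relative to those of `θ`. -/
noncomputable def kroneckerCoeff (q : ℂ) (k : ℤ) : ℂ :=
  if k < 0 then partialTheta q (q ^ (-k)) else 1 - partialTheta q (q ^ (k + 1))

theorem norm_zpow_le_one {q : ℂ} (hq : ‖q‖ < 1) {k : ℤ} (hk : 0 ≤ k) : ‖q ^ k‖ ≤ 1 := by
  lift k to ℕ using hk
  rw [zpow_natCast, norm_pow]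
  exact pow_le_one₀ (norm_nonneg _) hq.le

/-- The explicit power of `q` exhibits the decay as `k → +∞`. -/
theorem kroneckerCoeff_of_nonneg {q : ℂ} (h0 : q ≠ 0) (hq : ‖q‖ < 1) {k : ℤ} (hk : 0 ≤ k) :
    kroneckerCoeff q k = q ^ (k + 1) * partialTheta q (q ^ (k + 2)) := by
  rw [kroneckerCoeff, if_neg (by omega), partialTheta_eq hq (norm_zpow_le_one hq (by omega)),
    ← zpow_one_add₀ h0]
  ring_nf

/-- Away from `k = 0` this is the functional equation `partialTheta_eq`. The constant `1` in the
second branch of `kroneckerCoeff` makes the two branches fit at `k = 0`. -/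
theorem kroneckerCoeff_add {q : ℂ} (h0 : q ≠ 0) (hq : ‖q‖ < 1) (k : ℤ) :
    kroneckerCoeff q k + q ^ (-k) * kroneckerCoeff q (k - 1) = 1 := by
  rcases lt_trichotomy k 0 with hk | rfl | hk
  · rw [kroneckerCoeff, kroneckerCoeff, if_pos hk, if_pos (by omega),
      partialTheta_eq hq (norm_zpow_le_one hq (by omega)), ← zpow_one_add₀ h0]
    ring_nf
  · simp [kroneckerCoeff]
  · rw [kroneckerCoeff_of_nonneg h0 hq (by omega : 0 ≤ k - 1), kroneckerCoeff,
      if_neg (by omega), ← mul_assoc, ← zpow_add₀ h0]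
    ring_nf
    simp

/-- In the double series below, the first bound serves for `m ≥ 0` and the second for `m < 0`. -/
theorem exists_norm_kroneckerCoeff_le {q : ℂ} (h0 : q ≠ 0) (hq : ‖q‖ < 1) :
    ∃ C : ℝ, 0 ≤ C ∧ ∀ k : ℤ, ‖kroneckerCoeff q k‖ ≤ C ∧
      ‖kroneckerCoeff q k‖ ≤ C * ‖q‖ ^ (k + 1) := by
  refine ⟨∑' i : ℕ, ‖q‖ ^ (i.choose 2), tsum_nonneg fun i => by positivity, fun k => ?_⟩
  have hC : 0 ≤ ∑' i : ℕ, ‖q‖ ^ (i.choose 2) := tsum_nonneg fun i => by positivity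
  have hqp : 0 < ‖q‖ := norm_pos_iff.2 h0
  by_cases hk : k < 0
  · have h1 : ‖kroneckerCoeff q k‖ ≤ ∑' i : ℕ, ‖q‖ ^ (i.choose 2) := by
      rw [kroneckerCoeff, if_pos hk]
      exact norm_partialTheta_le hq (norm_zpow_le_one hq (by omega))
    refine ⟨h1, h1.trans (le_mul_of_one_le_right hC ?_)⟩
    exact one_le_zpow_of_nonpos₀ hqp hq.le (by omega)
  · have h1 : ‖kroneckerCoeff q k‖ ≤ (∑' i : ℕ, ‖q‖ ^ (i.choose 2)) * ‖q‖ ^ (k + 1) := by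
      rw [kroneckerCoeff_of_nonneg h0 hq (by omega), norm_mul, norm_zpow, mul_comm]
      gcongr
      exact norm_partialTheta_le hq (norm_zpow_le_one hq (by omega))
    refine ⟨h1.trans (mul_le_of_le_one_right hC ?_), h1⟩
    rw [← norm_zpow]
    exact norm_zpow_le_one hq (by omega)

/-- The expansion of `θ(b) / (1 - e(b + m τ))`, up to the constant `I`. -/
noncomputable def thetaQuotient (τ : ℂ) (m : ℤ) (b : ℂ) : ℂ :=
  ∑' n : ℤ, thetaTerm τ n b * kroneckerCoeff (e τ) (n - m)

theorem thetaTerm_add (τ : ℂ) (n : ℤ) (a b : ℂ) :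
    thetaTerm τ n (a + b) = e a ^ n * e (a / 2) * thetaTerm τ n b := by
  rw [← e_int_mul, ← e_add, thetaTerm, thetaTerm, mul_left_comm, ← e_add]
  ring_nf

theorem thetaTerm_succ (τ : ℂ) (n : ℤ) (b : ℂ) :
    thetaTerm τ (n + 1) b = -(e τ ^ (n + 1) * e b * thetaTerm τ n b) := by
  rw [← e_int_mul, ← e_add, ← neg_one_mul, ← exp_pi_mul_I, thetaTerm_eq_exp, thetaTerm_eq_exp, e,
    ← exp_add, ← exp_add]
  congr 1
  push_cast
  ring

theorem e_pow_ne_one {τ : ℂ} (hτ : 0 < τ.im) {m : ℤ} (hm : m ≠ 0) : e τ ^ m ≠ 1 := by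
  intro h
  have h1 := congrArg norm h
  rw [norm_zpow, norm_one] at h1
  have h2 := norm_e_lt_one hτ
  have h3 : 0 < ‖e τ‖ := norm_pos_iff.2 (e_ne_zero τ)
  exact hm ((zpow_eq_one_iff_right₀ h3.le h2.ne).1 h1)

theorem I_mul_theta (τ b : ℂ) : I * theta τ b = ∑' n : ℤ, thetaTerm τ n b := by
  rw [theta_eq_tsum, ← mul_assoc, mul_one_div_cancel I_ne_zero, one_mul]

theorem summable_thetaTerm_mul_coeff {τ : ℂ} (hτ : 0 < τ.im) (m : ℤ) (b : ℂ) :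
    Summable fun n : ℤ => thetaTerm τ n b * kroneckerCoeff (e τ) (n - m) := by
  obtain ⟨C, hC, h⟩ := exists_norm_kroneckerCoeff_le (e_ne_zero τ) (norm_e_lt_one hτ)
  refine ((summable_thetaTerm hτ b).norm.mul_right C).of_norm_bounded fun n => ?_
  rw [norm_mul]
  exact mul_le_mul_of_nonneg_left (h _).1 (norm_nonneg _)

/-- Multiplying by `q^m e(b)` shifts the index of the theta terms by one (`thetaTerm_succ`), and the
recurrence `kroneckerCoeff_add` then leaves coefficient `1`. No division occurs, so the identity
also holds at the zeros of the first factor. -/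
theorem one_sub_mul_thetaQuotient {τ : ℂ} (hτ : 0 < τ.im) (m : ℤ) (b : ℂ) :
    (1 - e τ ^ m * e b) * thetaQuotient τ m b = I * theta τ b := by
  have hs := summable_thetaTerm_mul_coeff hτ m b
  have h1 : e τ ^ m * e b * thetaQuotient τ m b
      = ∑' n : ℤ, -(e τ ^ (-(n - m)) * kroneckerCoeff (e τ) (n - m - 1) * thetaTerm τ n b) := by
    rw [thetaQuotient, ← tsum_mul_left, ← (Equiv.addRight (1 : ℤ)).tsum_eq
      (fun n => -(e τ ^ (-(n - m)) * kroneckerCoeff (e τ) (n - m - 1) * thetaTerm τ n b))]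
    refine tsum_congr fun n => ?_
    have h2 : e τ ^ m = e τ ^ (-(n + 1 - m)) * e τ ^ (n + 1) := by
      rw [← zpow_add₀ (e_ne_zero τ)]
      ring_nf
    rw [Equiv.coe_addRight, thetaTerm_succ, h2, show n + 1 - m - 1 = n - m by ring]
    ring
  have hs2 : Summable fun n : ℤ =>
      -(e τ ^ (-(n - m)) * kroneckerCoeff (e τ) (n - m - 1) * thetaTerm τ n b) := by
    refine (hs.sub (summable_thetaTerm hτ b)).congr fun n => ?_
    have := kroneckerCoeff_add (e_ne_zero τ) (norm_e_lt_one hτ) (n - m)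
    linear_combination (thetaTerm τ n b) * this
  rw [sub_mul, one_mul, h1, thetaQuotient, ← hs.tsum_sub hs2, I_mul_theta]
  refine tsum_congr fun n => ?_
  have := kroneckerCoeff_add (e_ne_zero τ) (norm_e_lt_one hτ) (n - m)
  linear_combination (thetaTerm τ n b) * this

theorem summable_pow_natAbs {r : ℝ} (h0 : 0 ≤ r) (h1 : r < 1) :
    Summable fun m : ℤ => r ^ m.natAbs := by
  have := summable_geometric_of_lt_one h0 h1
  exact Summable.of_nat_of_neg (by simpa using this) (by simpa using this)

/-- For `m ≥ 0` the decay comes from `|e(a)| < 1`. For `m = -j < 0` the bound by `|q|^(n+j+1)` turns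
`|e(a)|^(-j)` into `|e(τ-a)|^j`, and the remaining `|q|^(n+1)` moves the theta term from `b` to `τ +
b`. -/
theorem summable_kronecker_double {τ a : ℂ} (ha : 0 < a.im) (haτ : a.im < τ.im) (b : ℂ) :
    Summable fun p : ℤ × ℤ =>
      e a ^ p.1 * (thetaTerm τ p.2 b * kroneckerCoeff (e τ) (p.2 - p.1)) := by
  have hτ : 0 < τ.im := ha.trans haτ
  obtain ⟨C, hC, h⟩ := exists_norm_kroneckerCoeff_le (e_ne_zero τ) (norm_e_lt_one hτ)
  set ρ := max ‖e a‖ ‖e (τ - a)‖ with hρ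
  have hρ0 : 0 ≤ ρ := le_max_of_le_left (norm_nonneg _)
  have hρ1 : ρ < 1 := max_lt (norm_e_lt_one ha) (norm_e_lt_one (by simpa using haτ))
  have hG : Summable fun n : ℤ =>
      C * (‖thetaTerm τ n b‖ + ‖e (τ / 2)‖ * ‖thetaTerm τ n (τ + b)‖) :=
    ((summable_thetaTerm hτ b).norm.add
      ((summable_thetaTerm hτ (τ + b)).norm.mul_left _)).mul_left C
  refine ((summable_pow_natAbs hρ0 hρ1).mul_of_nonneg hG (fun m => by positivity)
    (fun n => by positivity)).of_norm_bounded fun ⟨m, n⟩ => ?_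
  dsimp only
  rw [norm_mul, norm_mul, norm_zpow]
  have hA : 0 < ‖e a‖ := norm_pos_iff.2 (e_ne_zero a)
  have hQ : 0 < ‖e τ‖ := norm_pos_iff.2 (e_ne_zero τ)
  rcases le_or_gt 0 m with hm | hm
  · lift m to ℕ using hm
    rw [zpow_natCast, Int.natAbs_natCast]
    refine mul_le_mul (pow_le_pow_left₀ hA.le (le_max_left _ _) _) ?_ (by positivity)
      (by positivity)
    rw [mul_comm C]
    refine mul_le_mul (le_add_of_nonneg_right (by positivity)) (h _).1 (norm_nonneg _)
      (by positivity)
  · obtain ⟨j, rfl⟩ : ∃ j : ℕ, m = -j := ⟨m.natAbs, by omega⟩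
    rw [Int.natAbs_neg, Int.natAbs_natCast]
    have h1 := (h (n - -j)).2
    have h2 : ‖e a‖ ^ (-(j : ℤ)) * ‖e τ‖ ^ (n - -(j : ℤ) + 1)
        = ‖e (τ - a)‖ ^ j * (‖e τ‖ ^ n * ‖e τ‖) := by
      rw [e_sub, norm_div, div_pow, zpow_neg, zpow_natCast,
        show n - -(j : ℤ) + 1 = j + n + 1 by ring, zpow_add₀ hQ.ne', zpow_add₀ hQ.ne',
        zpow_natCast, zpow_one]
      field_simp
    have h3 : ‖e (τ / 2)‖ * ‖thetaTerm τ n (τ + b)‖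
        = ‖e τ‖ ^ n * ‖e τ‖ * ‖thetaTerm τ n b‖ := by
      have h4 : ‖e τ‖ = ‖e (τ / 2)‖ * ‖e (τ / 2)‖ := by
        rw [← norm_mul, ← e_add, add_halves]
      rw [thetaTerm_add, norm_mul, norm_mul, norm_zpow]
      nth_rewrite 3 [h4]
      ring
    calc ‖e a‖ ^ (-(j : ℤ)) * (‖thetaTerm τ n b‖ * ‖kroneckerCoeff (e τ) (n - -j)‖)
        ≤ ‖e a‖ ^ (-(j : ℤ)) * (‖thetaTerm τ n b‖ * (C * ‖e τ‖ ^ (n - -(j : ℤ) + 1))) := by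
          gcongr
      _ = ‖e (τ - a)‖ ^ j * (C * (‖e (τ / 2)‖ * ‖thetaTerm τ n (τ + b)‖)) := by
          rw [h3]
          linear_combination (‖thetaTerm τ n b‖ * C) * h2
      _ ≤ ρ ^ j * (C * (‖thetaTerm τ n b‖ + ‖e (τ / 2)‖ * ‖thetaTerm τ n (τ + b)‖)) := by
          gcongr
          · exact le_max_right _ _
          · exact le_add_of_nonneg_left (norm_nonneg _)

theorem summable_e_pow_mul_thetaQuotient {τ a : ℂ} (ha : 0 < a.im) (haτ : a.im < τ.im) (b : ℂ) :
    Summable fun m : ℤ => e a ^ m * thetaQuotient τ m b := by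
  refine (summable_kronecker_double ha haτ b).prod.congr fun m => ?_
  dsimp only
  rw [tsum_mul_left, thetaQuotient]

/-- After exchanging the sums and putting `k = n - m`, the sum over `k` no longer involves `b` or
`n`, and `e(a)^n` turns the theta series at `b` into the one at `a + b`. -/
theorem exists_tsum_thetaQuotient {τ a : ℂ} (ha : 0 < a.im) (haτ : a.im < τ.im) :
    ∃ U : ℂ, ∀ b : ℂ, ∑' m : ℤ, e a ^ m * thetaQuotient τ m b = U * theta τ (a + b) := by
  refine ⟨(∑' k : ℤ, e a ^ (-k) * kroneckerCoeff (e τ) k) * (e (a / 2))⁻¹ * I, fun b => ?_⟩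
  have h := (summable_kronecker_double ha haτ b).tsum_comm (f := fun m n : ℤ =>
      e a ^ m * (thetaTerm τ n b * kroneckerCoeff (e τ) (n - m)))
  simp only [tsum_mul_left] at h
  rw [mul_assoc, I_mul_theta, ← tsum_mul_left]
  refine h.symm.trans (tsum_congr fun n => ?_)
  rw [← (Equiv.subLeft n).tsum_eq, thetaTerm_add, mul_assoc, mul_assoc (e a ^ n),
    mul_left_comm (e a ^ n), inv_mul_cancel_left₀ (e_ne_zero _), ← tsum_mul_right]
  refine tsum_congr fun k => ?_
  rw [Equiv.subLeft_apply, sub_sub_cancel, sub_eq_neg_add, zpow_add₀ (e_ne_zero a)]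
  ring

/-- The constant is found at `b = 0`: since `θ(0) = 0` and `1 - q^m ≠ 0` for `m ≠ 0`, only the term
`m = 0` survives. -/
theorem tsum_thetaQuotient_mul_theta {τ a : ℂ} (ha : 0 < a.im) (haτ : a.im < τ.im) (b : ℂ) :
    (∑' m : ℤ, e a ^ m * thetaQuotient τ m b) * theta τ a
      = thetaQuotient τ 0 0 * theta τ (a + b) := by
  have hτ : 0 < τ.im := ha.trans haτ
  obtain ⟨U, hU⟩ := exists_tsum_thetaQuotient ha haτ
  have h0 : ∀ m : ℤ, m ≠ 0 → e a ^ m * thetaQuotient τ m 0 = 0 := fun m hm => by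
    have h := one_sub_mul_thetaQuotient hτ m 0
    rw [theta_zero, mul_zero, e_zero, mul_one] at h
    rw [(mul_eq_zero.1 h).resolve_left (sub_ne_zero.2 (e_pow_ne_one hτ hm).symm), mul_zero]
  have h1 := hU 0
  rw [tsum_eq_single 0 h0, add_zero, zpow_zero, one_mul] at h1
  rw [hU, h1]
  ring

/-- Divide `(1 - e(x)) · thetaQuotient τ 0 x = I θ(x)` by `x` and let `x → 0`. -/
theorem I_mul_deriv_theta_zero {τ : ℂ} (hτ : 0 < τ.im) :
    I * deriv (theta τ) 0 = -(2 * (Real.pi : ℂ) * I) * thetaQuotient τ 0 0 := by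
  obtain ⟨C, hC, h⟩ := exists_norm_kroneckerCoeff_le (e_ne_zero τ) (norm_e_lt_one hτ)
  have hcont : Continuous fun x : ℝ => thetaQuotient τ 0 x := by
    refine continuous_tsum (u := fun n => ‖thetaTerm τ n 0‖ * C) (fun n => ?_)
      ((summable_thetaTerm hτ 0).norm.mul_right C) (fun n x => ?_)
    · unfold thetaTerm e
      fun_prop
    -- Along the real line the norms of the terms are constant, which gives a uniform majorant.
    · have hx : ‖thetaTerm τ n x‖ = ‖thetaTerm τ n 0‖ := by
        rw [← add_zero (x : ℂ), thetaTerm_add, norm_mul, norm_mul, norm_zpow, norm_e, norm_e]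
        simp
      rw [norm_mul, hx]
      exact mul_le_mul_of_nonneg_left (h _).1 (norm_nonneg _)
  have h1 : HasDerivAt (fun x : ℝ => I * theta τ x) (I * deriv (theta τ) 0) 0 :=
    ((hasDerivAt_theta_zero hτ).comp_ofReal (z := 0)).const_mul I
  have h2 : HasDerivAt (fun x : ℝ => 1 - e x) (-(2 * (Real.pi : ℂ) * I)) 0 := by
    have : HasDerivAt e (2 * (Real.pi : ℂ) * I) 0 := by
      have := ((hasDerivAt_id (0 : ℂ)).const_mul (2 * (Real.pi : ℂ) * I)).cexp
      simp only [id_eq, mul_zero, exp_zero, one_mul, mul_one] at this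
      exact this
    simpa using (this.comp_ofReal (z := 0)).const_sub 1
  rw [hasDerivAt_iff_tendsto_slope_zero] at h1 h2
  have h3 := h2.mul ((hcont.tendsto 0).mono_left (nhdsWithin_le_nhds (s := {0}ᶜ)))
  refine tendsto_nhds_unique h1 (h3.congr fun x => ?_)
  have h4 := one_sub_mul_thetaQuotient hτ 0 x
  rw [zpow_zero, one_mul] at h4
  simp only [zero_add, ← h4, ofReal_zero, e_zero, theta_zero, sub_self, sub_zero, mul_zero,
    smul_mul_assoc]

/-- Kronecker's series for `Δ`. -/
theorem hasSum_Delta {τ a b : ℂ} (ha : 0 < a.im) (haτ : a.im < τ.im) (hta : theta τ a ≠ 0)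
    (htb : theta τ b ≠ 0) :
    HasSum (fun m : ℤ => e a ^ m / (1 - e τ ^ m * e b))
      (-(Delta τ a b / (2 * (Real.pi : ℂ) * I))) := by
  have hτ : 0 < τ.im := ha.trans haτ
  have h1 := (summable_e_pow_mul_thetaQuotient ha haτ b).hasSum
  have hb : I * theta τ b ≠ 0 := mul_ne_zero I_ne_zero htb
  have hpi : 2 * (Real.pi : ℂ) * I ≠ 0 := two_pi_I_ne_zero
  convert! h1.div_const (I * theta τ b) using 1
  · funext m
    rw [← one_sub_mul_thetaQuotient hτ m b] at hb ⊢
    rw [mul_div_mul_right _ _ (right_ne_zero_of_mul hb)]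
  · have h2 := tsum_thetaQuotient_mul_theta ha haτ b
    have h3 : deriv (theta τ) 0 = -(2 * (Real.pi : ℂ)) * thetaQuotient τ 0 0 := by
      apply mul_left_cancel₀ I_ne_zero
      rw [I_mul_deriv_theta_zero hτ]
      ring
    rw [eq_div_iff hb, Delta]
    apply mul_right_cancel₀ hta
    rw [h2]
    field_simp
    linear_combination (-theta τ (a + b)) * h3

/-! ### The multiplication formula over the torsion points. -/

theorem Delta_add_tau (τ a b : ℂ) : Delta τ (a + τ) b = e (-b) * Delta τ a b := by
  have h : a + τ + b = (a + b) + τ := by ring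
  have h1 : e (-(τ / 2) - (a + b)) = e (-(τ / 2) - a) * e (-b) := by
    rw [← e_add]
    ring_nf
  have h2 : -e (-(τ / 2) - a) ≠ 0 := neg_ne_zero.2 (e_ne_zero _)
  have h3 : deriv (theta τ) 0 * (-(e (-(τ / 2) - a) * e (-b)) * theta τ (a + b))
      = -e (-(τ / 2) - a) * (e (-b) * (deriv (theta τ) 0 * theta τ (a + b))) := by ring
  rw [Delta, Delta, h, theta_add_tau, theta_add_tau, h1, mul_assoc (-e (-(τ / 2) - a)), h3,
    mul_div_mul_left _ _ h2, mul_div_assoc]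

/-- With `N = n - 1` this undoes the translation that brings `n a` into the strip where Kronecker's
series converges. -/
theorem Delta_sub_nat_mul_tau (τ a b : ℂ) (N : ℕ) :
    Delta τ (a - N * τ) b = e (N * b) * Delta τ a b := by
  induction N with
  | zero => simp [e_zero]
  | succ N ih =>
    have h := Delta_add_tau τ (a - (N + 1 : ℕ) * τ) b
    have h1 : a - (N + 1 : ℕ) * τ + τ = a - N * τ := by push_cast; ring
    rw [h1, ih] at h
    have h2 : e ((N + 1 : ℕ) * b) = e (N * b) * e b := by
      rw [← e_add]; push_cast; ring_nf
    rw [h2, mul_right_comm, h, e_neg, mul_right_comm, inv_mul_cancel₀ (e_ne_zero b), one_mul]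

theorem one_sub_e_pow_mul_ne_zero {τ b : ℂ} (hτ : 0 < τ.im) (hb : theta τ b ≠ 0) (m : ℤ) :
    1 - e τ ^ m * e b ≠ 0 := by
  have h := one_sub_mul_thetaQuotient hτ m b
  exact left_ne_zero_of_mul (h.trans_ne (mul_ne_zero I_ne_zero hb))

theorem sum_e_div_eq_zero {n : ℕ} (hn : 0 < n) {m : ℤ} (hm : ¬ (n : ℤ) ∣ m) :
    ∑ k ∈ Finset.range n, e ((m : ℂ) / n) ^ k = 0 := by
  have hn0 : (n : ℂ) ≠ 0 := by exact_mod_cast hn.ne'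
  have h1 : e ((m : ℂ) / n) ≠ 1 := by
    intro h
    obtain ⟨j, hj⟩ := exp_eq_one_iff.1 h
    have h2 : (m : ℂ) / n = j := by
      apply mul_left_cancel₀ two_pi_I_ne_zero
      rw [hj]
      ring
    rw [div_eq_iff hn0] at h2
    exact hm ⟨j, by rw [mul_comm]; exact_mod_cast h2⟩
  rw [geom_sum_eq h1, ← e_nat_mul, mul_div_cancel₀ _ hn0, e_intCast, sub_self, zero_div]

/-- Summation over `l` trades the denominator `1 - X^n`, belonging to `nβ`, for `1 - X`, belonging
to `β`. -/
theorem geom_sum_inv_div {X : ℂ} {n : ℕ} (hn : 0 < n) (h0 : X ≠ 0) (h1 : 1 - X ≠ 0)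
    (h2 : 1 - X ^ n ≠ 0) :
    (∑ l ∈ Finset.range n, X⁻¹ ^ l) / (1 - X ^ n) = X⁻¹ ^ (n - 1) / (1 - X) := by
  obtain ⟨N, rfl⟩ : ∃ N, n = N + 1 := ⟨n - 1, by omega⟩
  have h := geom_sum_mul X⁻¹ (N + 1)
  have h3 : X⁻¹ - 1 = (1 - X) * X⁻¹ := by field_simp
  have h4 : X⁻¹ ^ (N + 1) - 1 = X⁻¹ ^ N * (1 - X ^ (N + 1)) * X⁻¹ := by
    simp only [inv_pow, pow_succ]
    field_simp
  rw [h3, h4, ← mul_assoc] at h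
  rw [div_eq_div_iff h2 h1, mul_right_cancel₀ (inv_ne_zero h0) h, Nat.add_sub_cancel]

/-- The multiplication formula for `Δ`, in a strip where Kronecker's series converges. -/
theorem sum_Delta_torsion_of_strip {n : ℕ} (hn : 0 < n) {τ a β : ℂ} (hτ : 0 < τ.im)
    (ha : ((n : ℝ) - 1) * τ.im < n * a.im) (ha' : a.im < τ.im)
    (hβ : theta τ β ≠ 0) (hnβ : theta τ (n * β) ≠ 0) (hna : theta τ (n * a - (n - 1 : ℕ) * τ) ≠ 0)
    (h : ∀ k ∈ Finset.range n, ∀ l ∈ Finset.range n,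
      theta τ (a + ((k : ℂ) - (l : ℂ) * τ) / n) ≠ 0) :
    ∑ k ∈ Finset.range n, ∑ l ∈ Finset.range n,
      e (-(l * β)) * Delta τ (a + ((k : ℂ) - (l : ℂ) * τ) / n) (n * β)
      = n * Delta τ (n * a) β := by
  have hn0 : (n : ℂ) ≠ 0 := by exact_mod_cast hn.ne'
  have hnR : (0 : ℝ) < n := by exact_mod_cast hn
  have him : ∀ k l : ℕ, (a + ((k : ℂ) - (l : ℂ) * τ) / n).im = a.im - l * τ.im / n := by
    intro k l
    rw [add_im, ← ofReal_natCast n, div_ofReal_im]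
    simp
    ring
  have h1 : ∀ k ∈ Finset.range n, ∀ l ∈ Finset.range n,
      HasSum (fun m : ℤ => e (-(l * β)) * (e (a + ((k : ℂ) - (l : ℂ) * τ) / n) ^ m
          / (1 - e τ ^ m * e (n * β))))
        (e (-(l * β)) * -(Delta τ (a + ((k : ℂ) - (l : ℂ) * τ) / n) (n * β)
          / (2 * (Real.pi : ℂ) * I))) := by
    intro k hk l hl
    have hl' : (l : ℝ) ≤ n - 1 := by
      have : l + 1 ≤ n := Finset.mem_range.1 hl
      have : (l : ℝ) + 1 ≤ n := by exact_mod_cast this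
      linarith
    -- Since `l ≤ n - 1`, the lower bound on `Im a` keeps every translate `a + (k - lτ)/n` inside
    -- the strip.
    refine (hasSum_Delta ?_ ?_ (h k hk l hl) hnβ).mul_left _
    · rw [him, sub_pos, div_lt_iff₀ hnR]
      nlinarith
    · rw [him]
      have : 0 ≤ l * τ.im / n := by positivity
      linarith
  have h2 := hasSum_sum fun k hk => hasSum_sum fun l hl => h1 k hk l hl
  have hinj : Function.Injective fun j : ℤ => (n : ℤ) * j :=
    mul_right_injective₀ (by exact_mod_cast hn.ne')
  have hterm : ∀ (k l : ℕ) (m : ℤ), e (a + ((k : ℂ) - (l : ℂ) * τ) / n) ^ m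
      = e (a - l * τ / n) ^ m * e ((m : ℂ) / n) ^ k := by
    intro k l m
    rw [← e_int_mul, ← e_int_mul, ← e_nat_mul, ← e_add]
    congr 1
    field_simp
    ring
  -- Only exponents `m = n j` contribute: for the others the sum over `k` is a full sum of powers of
  -- a nontrivial `n`-th root of unity.
  rw [← hinj.hasSum_iff] at h2
  swap
  · intro m hm
    have hm' : ¬ (n : ℤ) ∣ m := fun ⟨j, hj⟩ => hm ⟨j, hj.symm⟩
    rw [Finset.sum_comm]
    refine Finset.sum_eq_zero fun l _ => ?_
    simp only [hterm, ← Finset.mul_sum, ← Finset.sum_div]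
    rw [sum_e_div_eq_zero hn hm']
    simp
  have h3 := (hasSum_Delta (τ := τ) (a := n * a - (n - 1 : ℕ) * τ) (b := β)
    (by simp [Nat.cast_pred hn]; linarith)
    (by simp [Nat.cast_pred hn]; nlinarith) hna hβ).mul_left (n * e (-((n - 1 : ℕ) * β)))
  have hfun : (fun j : ℤ => n * e (-((n - 1 : ℕ) * β))
        * (e (n * a - (n - 1 : ℕ) * τ) ^ j / (1 - e τ ^ j * e β)))
      = (fun m : ℤ => ∑ k ∈ Finset.range n, ∑ l ∈ Finset.range n,
        e (-(l * β)) * (e (a + ((k : ℂ) - (l : ℂ) * τ) / n) ^ m / (1 - e τ ^ m * e (n * β))))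
        ∘ fun j : ℤ => (n : ℤ) * j := by
    funext j
    -- Put `X = q^j e(β)`. At `m = n j` the summand is independent of `k` and geometric in `X⁻¹` as
    -- a function of `l`.
    have hX0 : e τ ^ j * e β ≠ 0 := mul_ne_zero (zpow_ne_zero _ (e_ne_zero _)) (e_ne_zero _)
    have hXn : e τ ^ (n * j : ℤ) * e (n * β) = (e τ ^ j * e β) ^ n := by
      rw [e_nat_mul, mul_pow, mul_comm (n : ℤ), zpow_mul, zpow_natCast]
    have hY : ∀ l : ℕ, (e τ ^ j * e β)⁻¹ ^ l = e (-(l * (j * τ + β))) := fun l => by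
      rw [inv_pow, ← e_int_mul, ← e_add, ← e_nat_mul, ← e_neg]
    have hgeom := geom_sum_inv_div hn hX0 (one_sub_e_pow_mul_ne_zero hτ hβ j)
      (by rw [← hXn]; exact one_sub_e_pow_mul_ne_zero hτ hnβ _)
    have hl : ∀ k l : ℕ, e (-(l * β)) * (e (a + ((k : ℂ) - (l : ℂ) * τ) / n) ^ (n * j : ℤ)
        / (1 - e τ ^ (n * j : ℤ) * e (n * β)))
        = e (n * a) ^ j * ((e τ ^ j * e β)⁻¹ ^ l / (1 - (e τ ^ j * e β) ^ n)) := by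
      intro k l
      have h5 : ((n * j : ℤ) : ℂ) / n = j := by
        push_cast
        exact mul_div_cancel_left₀ _ hn0
      rw [hterm, h5, e_intCast, one_pow, mul_one, hXn, mul_div_assoc', mul_div_assoc', hY,
        ← e_int_mul (n * j), ← e_int_mul j (n * a), ← e_add, ← e_add]
      congr 2
      push_cast
      field_simp
      ring
    simp only [Function.comp_apply, hl, ← Finset.mul_sum, ← Finset.sum_div, Finset.sum_const,
      Finset.card_range, nsmul_eq_mul]
    have hkey : e (-((n - 1 : ℕ) * β)) * e (n * a - (n - 1 : ℕ) * τ) ^ j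
        = e (n * a) ^ j * (e τ ^ j * e β)⁻¹ ^ (n - 1) := by
      rw [hY, ← e_int_mul, ← e_int_mul, ← e_add, ← e_add]
      ring_nf
    rw [mul_div_assoc (n : ℂ), hgeom]
    linear_combination (n / (1 - e τ ^ j * e β)) * hkey
  rw [← hfun] at h2
  have h4 := h3.unique h2
  rw [Delta_sub_nat_mul_tau, e_neg] at h4
  have hpi := two_pi_I_ne_zero
  have h5 : ∑ k ∈ Finset.range n, ∑ l ∈ Finset.range n, e (-(l * β))
        * -(Delta τ (a + ((k : ℂ) - (l : ℂ) * τ) / n) (n * β) / (2 * (Real.pi : ℂ) * I))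
      = -(∑ k ∈ Finset.range n, ∑ l ∈ Finset.range n, e (-(l * β))
        * Delta τ (a + ((k : ℂ) - (l : ℂ) * τ) / n) (n * β)) / (2 * (Real.pi : ℂ) * I) := by
    simp only [Finset.sum_div, ← Finset.sum_neg_distrib]
    exact Finset.sum_congr rfl fun k _ => Finset.sum_congr rfl fun l _ => by ring
  rw [h5, eq_div_iff hpi] at h4
  have h6 := e_ne_zero (((n - 1 : ℕ) : ℂ) * β)
  have h7 : n * (e ((n - 1 : ℕ) * β))⁻¹
      * -(e ((n - 1 : ℕ) * β) * Delta τ (n * a) β / (2 * (Real.pi : ℂ) * I))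
      * (2 * (Real.pi : ℂ) * I) = -(n * Delta τ (n * a) β) := by
    generalize Delta τ (n * a) β = D
    field_simp
  rw [h7] at h4
  exact (neg_injective h4).symm

theorem sum_mul_prod_erase {ι K : Type*} [DecidableEq ι] [Field K] (S : Finset ι) (f g : ι → K)
    (hf : ∀ p ∈ S, f p ≠ 0) :
    ∑ p ∈ S, g p * ∏ p' ∈ S.erase p, f p' = (∏ p ∈ S, f p) * ∑ p ∈ S, g p / f p := by
  rw [Finset.mul_sum]
  refine Finset.sum_congr rfl fun p hp => ?_
  rw [← Finset.mul_prod_erase S f hp]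
  have := hf p hp
  field_simp

/-- The multiplication formula for `Δ`. -/
theorem sum_Delta_torsion {n : ℕ} (hn : 0 < n) {τ a β : ℂ} (hτ : 0 < τ.im)
    (hβ : theta τ β ≠ 0) (hnβ : theta τ (n * β) ≠ 0) (hna : theta τ (n * a) ≠ 0)
    (h : ∀ k ∈ Finset.range n, ∀ l ∈ Finset.range n,
      theta τ (a + ((k : ℂ) - (l : ℂ) * τ) / n) ≠ 0) :
    ∑ k ∈ Finset.range n, ∑ l ∈ Finset.range n,
      e (-(l * β)) * Delta τ (a + ((k : ℂ) - (l : ℂ) * τ) / n) (n * β)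
      = n * Delta τ (n * a) β := by
  have hn0 : (n : ℂ) ≠ 0 := by exact_mod_cast hn.ne'
  have hnR : (0 : ℝ) < n := by exact_mod_cast hn
  set S := Finset.range n ×ˢ Finset.range n with hS
  set r : ℕ × ℕ → ℂ := fun p => ((p.1 : ℂ) - (p.2 : ℂ) * τ) / n with hr
  -- The difference of the two sides, multiplied by all denominators that depend on `a`; it is
  -- entire in `a`.
  let E : ℂ → ℂ := fun a =>
    (∑ p ∈ S, e (-(p.2 * β)) * (deriv (theta τ) 0 * theta τ (a + r p + n * β) / theta τ (n * β))
      * ∏ p' ∈ S.erase p, theta τ (a + r p')) * theta τ (n * a)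
    - n * (deriv (theta τ) 0 * theta τ (n * a + β) / theta τ β) * ∏ p ∈ S, theta τ (a + r p)
  have hE : ∀ a, theta τ (n * a) ≠ 0 → (∀ p ∈ S, theta τ (a + r p) ≠ 0) →
      E a = (∏ p ∈ S, theta τ (a + r p)) * theta τ (n * a)
        * (∑ p ∈ S, e (-(p.2 * β)) * Delta τ (a + r p) (n * β) - n * Delta τ (n * a) β) := by
    intro a h1 h2
    have h3 := sum_mul_prod_erase S (fun p => theta τ (a + r p)) (fun p => e (-(p.2 * β))
      * (deriv (theta τ) 0 * theta τ (a + r p + n * β) / theta τ (n * β))) h2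
    have h4 : ∀ p, e (-(p.2 * β)) * (deriv (theta τ) 0 * theta τ (a + r p + n * β)
        / theta τ (n * β)) / theta τ (a + r p)
        = e (-(p.2 * β)) * Delta τ (a + r p) (n * β) := fun p => by
      rw [Delta, mul_div_assoc, div_div, mul_comm (theta τ (n * β))]
    have h5 : Delta τ (n * a) β * theta τ (n * a)
        = deriv (theta τ) 0 * theta τ (n * a + β) / theta τ β := by
      rw [Delta, div_mul_eq_div_div_swap, div_mul_cancel₀ _ h1]
    simp only [h4] at h3
    simp only [E]
    rw [h3, ← h5]
    ring
  have hd := differentiable_theta hτ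
  have hEd : Differentiable ℂ E := by
    have h1 : ∀ d : ℂ, Differentiable ℂ fun a : ℂ => theta τ (a + d) := fun d =>
      hd.comp (by fun_prop)
    have h2 : ∀ d : ℂ, Differentiable ℂ fun a : ℂ => theta τ (n * a + d) := fun d =>
      hd.comp (by fun_prop)
    have h3 : ∀ T : Finset (ℕ × ℕ), Differentiable ℂ fun a : ℂ => ∏ p ∈ T, theta τ (a + r p) :=
      fun T a => DifferentiableAt.fun_finsetProd fun p _ => h1 (r p) a
    have h4 : Differentiable ℂ fun a : ℂ => theta τ (n * a) := hd.comp (by fun_prop)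
    refine Differentiable.sub (Differentiable.mul (Differentiable.fun_sum fun p _ => ?_) h4) ?_
    · refine Differentiable.mul (Differentiable.const_mul (Differentiable.div_const
        (Differentiable.const_mul ?_ _) _) _) (h3 _)
      simpa only [add_assoc] using h1 (r p + n * β)
    · exact Differentiable.mul (Differentiable.const_mul (Differentiable.div_const
        (Differentiable.const_mul (h2 β) _) _) _) (h3 S)
  -- `Im a₀` is the midpoint of the interval from `(n-1) Im τ / n` to `Im τ` allowed in
  -- `sum_Delta_torsion_of_strip`.
  set a₀ : ℂ := τ * ((n : ℂ) - 1 / 2) / n with ha₀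
  have hEz : ∀ᶠ s in 𝓝[≠] (0 : ℂ), E (a₀ + s) = 0 := by
    have h1 : ∀ᶠ s in 𝓝[≠] (0 : ℂ), theta τ (n * a₀ + n * s) ≠ 0 :=
      eventually_theta_ne_zero hτ _ hn0
    have h2 : ∀ᶠ s in 𝓝[≠] (0 : ℂ), ∀ p ∈ S, theta τ (a₀ + r p + 1 * s) ≠ 0 :=
      (Filter.eventually_all_finset S).2 fun p _ => eventually_theta_ne_zero hτ _ one_ne_zero
    have h3 : ∀ᶠ s in 𝓝[≠] (0 : ℂ), theta τ (n * a₀ - (n - 1 : ℕ) * τ + n * s) ≠ 0 :=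
      eventually_theta_ne_zero hτ _ hn0
    have ha₀im : a₀.im = τ.im * ((n : ℝ) - 1 / 2) / n := by
      rw [ha₀, ← ofReal_natCast n, div_ofReal_im]
      simp
    have h4 : ∀ᶠ s in 𝓝[≠] (0 : ℂ), ((n : ℝ) - 1) * τ.im < n * (a₀ + s).im ∧ (a₀ + s).im < τ.im := by
      have hc : Continuous fun s : ℂ => (a₀ + s).im :=
        continuous_im.comp (continuous_const.add continuous_id)
      refine eventually_nhdsWithin_of_eventually_nhds (Filter.Eventually.and
        ((isOpen_lt continuous_const (continuous_const.mul hc)).mem_nhds ?_)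
        ((isOpen_lt hc continuous_const).mem_nhds ?_))
      · change ((n : ℝ) - 1) * τ.im < n * (a₀ + 0).im
        rw [add_zero, ha₀im, mul_div_cancel₀ _ hnR.ne']
        nlinarith
      · change (a₀ + 0).im < τ.im
        rw [add_zero, ha₀im, div_lt_iff₀ hnR]
        nlinarith
    filter_upwards [h1, h2, h3, h4] with s h1 h2 h3 h4
    have e1 : (n : ℂ) * (a₀ + s) = n * a₀ + n * s := by ring
    have h2' : ∀ p ∈ S, theta τ (a₀ + s + r p) ≠ 0 := fun p hp => by
      have := h2 p hp
      rwa [one_mul, add_right_comm] at this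
    rw [hE _ (by rwa [e1]) h2', hS, Finset.sum_product]
    have := sum_Delta_torsion_of_strip hn hτ h4.1 h4.2 hβ hnβ
      (by rw [e1]; rwa [sub_add_eq_add_sub] at h3)
      (fun k hk l hl => h2' (k, l) (Finset.mk_mem_product hk hl))
    simp only [hr]
    rw [this, sub_self, mul_zero]
  have hE0 := AnalyticOnNhd.eqOn_zero_of_preconnected_of_frequently_eq_zero
    (f := fun s => E (a₀ + s)) (U := Set.univ) (𝕜 := ℂ)
    (fun s _ => (hEd.comp (by fun_prop)).analyticAt s) isPreconnected_univ
    (Set.mem_univ 0) hEz.frequently (Set.mem_univ (a - a₀))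
  simp only [add_sub_cancel, Pi.zero_apply] at hE0
  have h' : ∀ p ∈ S, theta τ (a + r p) ≠ 0 := fun p hp =>
    h p.1 (Finset.mem_product.1 hp).1 p.2 (Finset.mem_product.1 hp).2
  rw [hE a hna h', mul_eq_zero, or_iff_right (mul_ne_zero (Finset.prod_ne_zero_iff.2 h') hna),
    sub_eq_zero, hS, Finset.sum_product] at hE0
  exact hE0

/-! ### Equality of the two sums in additive variables. -/

/-- The linear forms in `log t₁`, `log t₂` occurring in `A n`. -/
noncomputable def argP (n : ℕ) (a₁ a₂ : ℂ) (j : ℕ) : ℂ := j * a₂ - (n - j) * a₁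

/-- The linear forms in `log μ₁`, `log μ₂` occurring in `A n`. -/
noncomputable def argC (n : ℕ) (b₁ b₂ : ℂ) (j : ℕ) : ℂ := j * b₁ + (n - j) * b₂

/-- `A n` in additive variables, up to the factor `(2πi)²`. -/
noncomputable def addA (n : ℕ) (a₁ a₂ b₁ b₂ τ : ℂ) : ℂ :=
  ∑ k ∈ Finset.range n, Delta τ (-argP n a₁ a₂ k) (argC n b₁ b₂ (k + 1))
    * Delta τ (argP n a₁ a₂ (k + 1)) (argC n b₁ b₂ k)

/-- `B n` in additive variables, up to the factor `(2πi)²`. -/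
noncomputable def addB (n : ℕ) (a₁ a₂ b₁ b₂ τ : ℂ) : ℂ :=
  1 / (n : ℂ) * ∑ k ∈ Finset.range n, ∑ l ∈ Finset.range n,
    e (l * (b₂ - b₁)) * Delta τ (((k : ℂ) - (l : ℂ) * τ) / (n : ℂ) + a₁) (n * b₁)
      * Delta τ ((τ * (l : ℂ) - (k : ℂ)) / (n : ℂ) + a₂) (n * b₂)

/-- All the summands of `addA` are defined. -/
def AddADefined (n : ℕ) (a₁ a₂ b₁ b₂ τ : ℂ) : Prop :=
  ∀ k ∈ Finset.range n, DeltaDefined τ (-argP n a₁ a₂ k) (argC n b₁ b₂ (k + 1))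
    ∧ DeltaDefined τ (argP n a₁ a₂ (k + 1)) (argC n b₁ b₂ k)

/-- All the summands of `addB` are defined. -/
def AddBDefined (n : ℕ) (a₁ a₂ b₁ b₂ τ : ℂ) : Prop :=
  ∀ k ∈ Finset.range n, ∀ l ∈ Finset.range n,
    DeltaDefined τ (((k : ℂ) - (l : ℂ) * τ) / (n : ℂ) + a₁) (n * b₁)
      ∧ DeltaDefined τ ((τ * (l : ℂ) - (k : ℂ)) / (n : ℂ) + a₂) (n * b₂)

/-- Consecutive `argP` differ by `a₁ + a₂` and consecutive `argC` by `b₁ - b₂`, so Fay's identity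
makes each summand a difference of neighbours; the ends `k = 0` and `k = n` remain. -/
theorem addA_eq {n : ℕ} {a₁ a₂ b₁ b₂ τ : ℂ} (hτ : 0 < τ.im)
    (h : AddADefined n a₁ a₂ b₁ b₂ τ) (hα : theta τ (a₁ + a₂) ≠ 0)
    (hβ : theta τ (b₁ - b₂) ≠ 0) :
    addA n a₁ a₂ b₁ b₂ τ = Delta τ (a₁ + a₂) (n * b₂) * Delta τ (n * a₁) (b₁ - b₂)
      - Delta τ (a₁ + a₂) (n * b₁) * Delta τ (n * -a₂) (b₁ - b₂) := by
  have h1 : ∀ k ∈ Finset.range n, Delta τ (-argP n a₁ a₂ k) (argC n b₁ b₂ (k + 1))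
      * Delta τ (argP n a₁ a₂ (k + 1)) (argC n b₁ b₂ k)
      = Delta τ (a₁ + a₂) (argC n b₁ b₂ k) * Delta τ (-argP n a₁ a₂ k) (b₁ - b₂)
        - Delta τ (a₁ + a₂) (argC n b₁ b₂ (k + 1))
          * Delta τ (-argP n a₁ a₂ (k + 1)) (b₁ - b₂) := by
    intro k hk
    obtain ⟨⟨h1, h2⟩, h3, h4⟩ := h k hk
    have e1 : -argP n a₁ a₂ k + argP n a₁ a₂ (k + 1) = a₁ + a₂ := by
      simp only [argP]; push_cast; ring
    have e2 : argC n b₁ b₂ (k + 1) - argC n b₁ b₂ k = b₁ - b₂ := by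
      simp only [argC]; push_cast; ring
    have e3 : argC n b₁ b₂ k - argC n b₁ b₂ (k + 1) = -(b₁ - b₂) := by rw [← e2, neg_sub]
    have e4 := Delta_neg_neg τ (-argP n a₁ a₂ (k + 1)) (b₁ - b₂)
    rw [neg_neg] at e4
    rw [Delta_mul_Delta hτ h1 h3 h2 h4 (by rwa [e1]) (by rwa [e2]), e1, e2, e3, e4]
    ring
  rw [addA, Finset.sum_congr rfl h1, Finset.sum_range_sub']
  simp [argP, argC]

/-- The two torsion shifts are opposite, so Fay's identity pulls out factors free of `k` and `l`.
The multiplication formula with `β = b₁ - b₂`, at `a₁` and at `-a₂`, does the remaining sums. -/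
theorem addB_eq {n : ℕ} (hn : 0 < n) {a₁ a₂ b₁ b₂ τ : ℂ} (hτ : 0 < τ.im)
    (h : AddBDefined n a₁ a₂ b₁ b₂ τ) (ha₁ : theta τ (n * a₁) ≠ 0) (ha₂ : theta τ (n * a₂) ≠ 0)
    (hα : theta τ (a₁ + a₂) ≠ 0) (hβ : theta τ (b₁ - b₂) ≠ 0)
    (hnβ : theta τ (n * (b₁ - b₂)) ≠ 0) :
    addB n a₁ a₂ b₁ b₂ τ = Delta τ (a₁ + a₂) (n * b₂) * Delta τ (n * a₁) (b₁ - b₂)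
      - Delta τ (a₁ + a₂) (n * b₁) * Delta τ (n * -a₂) (b₁ - b₂) := by
  have hn0 : (n : ℂ) ≠ 0 := by exact_mod_cast hn.ne'
  have eneg : ∀ k l : ℕ, -a₂ + ((k : ℂ) - (l : ℂ) * τ) / n
      = -((τ * (l : ℂ) - (k : ℂ)) / n + a₂) := fun k l => by ring
  have h1 : ∀ k ∈ Finset.range n, ∀ l ∈ Finset.range n,
      e (l * (b₂ - b₁)) * Delta τ (((k : ℂ) - (l : ℂ) * τ) / (n : ℂ) + a₁) (n * b₁)
        * Delta τ ((τ * (l : ℂ) - (k : ℂ)) / (n : ℂ) + a₂) (n * b₂)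
      = Delta τ (a₁ + a₂) (n * b₂) * (e (-(l * (b₁ - b₂)))
          * Delta τ (a₁ + ((k : ℂ) - (l : ℂ) * τ) / n) (n * (b₁ - b₂)))
        - Delta τ (a₁ + a₂) (n * b₁) * (e (-(l * (b₁ - b₂)))
          * Delta τ (-a₂ + ((k : ℂ) - (l : ℂ) * τ) / n) (n * (b₁ - b₂))) := by
    intro k hk l hl
    obtain ⟨⟨h1, h2⟩, h3, h4⟩ := h k hk l hl
    have e1 : ((k : ℂ) - (l : ℂ) * τ) / n + a₁ + ((τ * (l : ℂ) - (k : ℂ)) / n + a₂)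
        = a₁ + a₂ := by ring
    have e2 : n * b₁ - n * b₂ = n * (b₁ - b₂) := by ring
    have e3 : n * b₂ - n * b₁ = -(n * (b₁ - b₂)) := by ring
    have e4 : -(l * (b₁ - b₂)) = l * (b₂ - b₁) := by ring
    rw [mul_assoc, Delta_mul_Delta hτ h1 h3 h2 h4 (by rwa [e1]) (by rwa [e2]), e1, e2, e3, e4,
      eneg, ← neg_neg (n * (b₁ - b₂)), Delta_neg_neg, neg_neg, add_comm a₁ (_ / _)]
    ring
  have s1 := sum_Delta_torsion hn hτ hβ hnβ ha₁ fun k hk l hl => by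
    rw [add_comm]
    exact (h k hk l hl).1.1
  have s2 := sum_Delta_torsion (a := -a₂) hn hτ hβ hnβ
    (by rwa [mul_neg, theta_neg, neg_ne_zero]) fun k hk l hl => by
      rw [eneg, theta_neg, neg_ne_zero]
      exact (h k hk l hl).2.1
  rw [addB, Finset.sum_congr rfl fun k hk => Finset.sum_congr rfl (h1 k hk)]
  simp only [Finset.sum_sub_distrib, ← Finset.mul_sum]
  rw [s1, s2]
  field_simp

theorem continuousAt_Delta {X : Type*} [TopologicalSpace X] {τ : ℂ} (hτ : 0 < τ.im)
    {f g : X → ℂ} {s : X} (hf : ContinuousAt f s) (hg : ContinuousAt g s)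
    (h : DeltaDefined τ (f s) (g s)) : ContinuousAt (fun x => Delta τ (f x) (g x)) s := by
  have hc := (differentiable_theta hτ).continuous
  unfold Delta
  exact (continuousAt_const.mul (hc.continuousAt.comp (hf.add hg))).div
    ((hc.continuousAt.comp hf).mul (hc.continuousAt.comp hg)) (mul_ne_zero h.1 h.2)

theorem eventually_DeltaDefined {X : Type*} [TopologicalSpace X] {τ : ℂ} (hτ : 0 < τ.im)
    {f g : X → ℂ} {s : X} (hf : ContinuousAt f s) (hg : ContinuousAt g s)
    (h : DeltaDefined τ (f s) (g s)) : ∀ᶠ x in 𝓝 s, DeltaDefined τ (f x) (g x) := by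
  have hc := (differentiable_theta hτ).continuous
  exact ((hc.continuousAt.comp hf).eventually_ne h.1).and
    ((hc.continuousAt.comp hg).eventually_ne h.2)

/-- Moving `a₁` and `b₁` by a small `s ≠ 0` makes the extra theta values at `a₁ + a₂`, `b₁ - b₂` and
`n(b₁ - b₂)` nonzero; both sums are continuous at `s = 0`. -/
theorem addA_eq_addB {n : ℕ} (hn : 0 < n) {a₁ a₂ b₁ b₂ τ : ℂ} (hτ : 0 < τ.im)
    (hA : AddADefined n a₁ a₂ b₁ b₂ τ) (hB : AddBDefined n a₁ a₂ b₁ b₂ τ) :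
    addA n a₁ a₂ b₁ b₂ τ = addB n a₁ a₂ b₁ b₂ τ := by
  have hn0 : (n : ℂ) ≠ 0 := by exact_mod_cast hn.ne'
  have cP : ∀ j, Continuous fun s : ℂ => argP n (a₁ + s) a₂ j := fun j => by
    unfold argP
    fun_prop
  have cC : ∀ j, Continuous fun s : ℂ => argC n (b₁ + s) b₂ j := fun j => by
    unfold argC
    fun_prop
  have cR : ∀ r : ℂ, Continuous fun s : ℂ => r + (a₁ + s) := fun r => by fun_prop
  have cM : Continuous fun s : ℂ => n * (b₁ + s) := by fun_prop
  have ce : Continuous e := differentiable_e.continuous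
  have hA0 : AddADefined n (a₁ + 0) a₂ (b₁ + 0) b₂ τ := by simpa only [add_zero] using hA
  have hB0 : AddBDefined n (a₁ + 0) a₂ (b₁ + 0) b₂ τ := by simpa only [add_zero] using hB
  have evA : ∀ᶠ s in 𝓝 (0 : ℂ), AddADefined n (a₁ + s) a₂ (b₁ + s) b₂ τ := by
    refine (Filter.eventually_all_finset _).2 fun k hk => ?_
    exact (eventually_DeltaDefined hτ (cP k).neg.continuousAt (cC (k + 1)).continuousAt
      (hA0 k hk).1).and
      (eventually_DeltaDefined hτ (cP (k + 1)).continuousAt (cC k).continuousAt (hA0 k hk).2)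
  have evB : ∀ᶠ s in 𝓝 (0 : ℂ), AddBDefined n (a₁ + s) a₂ (b₁ + s) b₂ τ := by
    refine (Filter.eventually_all_finset _).2 fun k hk =>
      (Filter.eventually_all_finset _).2 fun l hl => ?_
    exact (eventually_DeltaDefined hτ (cR _).continuousAt cM.continuousAt (hB0 k hk l hl).1).and
      (Filter.Eventually.of_forall fun _ => (hB0 k hk l hl).2)
  have tA : ContinuousAt (fun s : ℂ => addA n (a₁ + s) a₂ (b₁ + s) b₂ τ) 0 :=
    tendsto_finsetSum _ fun k hk =>
      (continuousAt_Delta hτ (cP k).neg.continuousAt (cC (k + 1)).continuousAt (hA0 k hk).1).mul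
      (continuousAt_Delta hτ (cP (k + 1)).continuousAt (cC k).continuousAt (hA0 k hk).2)
  have tB : ContinuousAt (fun s : ℂ => addB n (a₁ + s) a₂ (b₁ + s) b₂ τ) 0 := by
    refine continuousAt_const.mul (tendsto_finsetSum _ fun k hk => tendsto_finsetSum _ fun l hl =>
      ContinuousAt.mul (ContinuousAt.mul ?_ ?_) ?_)
    · exact (ce.comp (by fun_prop)).continuousAt
    · exact continuousAt_Delta hτ (cR _).continuousAt cM.continuousAt (hB0 k hk l hl).1
    · exact continuousAt_const
  have hev : ∀ᶠ s in 𝓝[≠] (0 : ℂ), addA n (a₁ + s) a₂ (b₁ + s) b₂ τ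
      = addB n (a₁ + s) a₂ (b₁ + s) b₂ τ := by
    filter_upwards [eventually_nhdsWithin_of_eventually_nhds evA,
      eventually_nhdsWithin_of_eventually_nhds evB,
      eventually_theta_ne_zero hτ (a₁ + a₂) one_ne_zero,
      eventually_theta_ne_zero hτ (b₁ - b₂) one_ne_zero,
      eventually_theta_ne_zero hτ (n * (b₁ - b₂)) hn0] with s h1 h2 h3 h4 h5
    rw [one_mul, add_right_comm] at h3
    rw [one_mul, sub_add_eq_add_sub] at h4
    have e5 : n * (b₁ - b₂) + n * s = n * (b₁ + s - b₂) := by ring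
    rw [e5] at h5
    -- The first and last summands of `addA` already contain `θ(n a₁)` and `θ(n a₂)`, at the
    -- perturbed `a₁`, as denominators.
    have h6 := (h1 0 (Finset.mem_range.2 hn)).1.1
    have h7 := (h1 (n - 1) (Finset.mem_range.2 (by omega))).2.1
    rw [Nat.sub_add_cancel hn] at h7
    rw [addA_eq hτ h1 h3 h4, addB_eq hn hτ h2 (by simpa [argP] using h6)
      (by simpa [argP] using h7) h3 h4 h5]
  have := tendsto_nhds_unique ((tA.tendsto.mono_left nhdsWithin_le_nhds).congr' hev)
    (tB.tendsto.mono_left nhdsWithin_le_nhds)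
  simpa only [add_zero] using this

/-! ### Back to multiplicative variables, and the specialization. -/

theorem e_argP {n j : ℕ} (hj : j ≤ n) (a₁ a₂ : ℂ) :
    e (argP n a₁ a₂ j) = e a₂ ^ j / e a₁ ^ (n - j) := by
  rw [argP, e_sub, ← Nat.cast_sub hj, e_nat_mul, e_nat_mul]

theorem e_neg_argP {n j : ℕ} (hj : j ≤ n) (a₁ a₂ : ℂ) :
    e (-argP n a₁ a₂ j) = e a₁ ^ (n - j) / e a₂ ^ j := by
  rw [e_neg, e_argP hj, inv_div]

theorem e_argC {n j : ℕ} (hj : j ≤ n) (b₁ b₂ : ℂ) :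
    e (argC n b₁ b₂ j) = e b₁ ^ j * e b₂ ^ (n - j) := by
  rw [argC, e_add, ← Nat.cast_sub hj, e_nat_mul, e_nat_mul]

theorem deltaDefined_e (τ a b : ℂ) : deltaDefined τ (e a) (e b) ↔ DeltaDefined τ a b := by
  have h : ∀ a, theta τ (lg (e a)) ≠ 0 ↔ theta τ a ≠ 0 := fun a =>
    not_congr (theta_eq_zero_iff_of_e_eq (e_lg (e_ne_zero a)))
  simp only [deltaDefined, DeltaDefined, h, e_ne_zero, ne_eq, not_false_eq_true, true_and]

theorem A_e (n : ℕ) (a₁ a₂ b₁ b₂ τ : ℂ) :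
    A n (e a₁) (e a₂) (e b₁) (e b₂) τ
      = addA n a₁ a₂ b₁ b₂ τ * (1 / (2 * (Real.pi : ℂ) * I)) ^ 2 := by
  rw [A, addA, ← Finset.Ico_add_one_right_eq_Icc, Finset.sum_mul, Finset.range_eq_Ico,
    ← Finset.sum_Ico_add' _ 0 n 1]
  refine Finset.sum_congr rfl fun k hk => ?_
  have hk' : k < n := (Finset.mem_Ico.1 hk).2
  have h1 : n - (k + 1) + 1 = n - k := by omega
  rw [h1, Nat.add_sub_cancel, ← e_neg_argP hk'.le, ← e_argC hk'.le, ← e_argP hk', ← e_argC hk',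
    delta_e, delta_e]
  ring

theorem B_e (n : ℕ) (a₁ a₂ b₁ b₂ τ : ℂ) :
    B n (e a₁) (e a₂) (e b₁) (e b₂) τ
      = addB n a₁ a₂ b₁ b₂ τ * (1 / (2 * (Real.pi : ℂ) * I)) ^ 2 := by
  rw [B, addB, mul_assoc, Finset.sum_mul]
  congr 1
  refine Finset.sum_congr rfl fun k _ => ?_
  rw [Finset.sum_mul]
  refine Finset.sum_congr rfl fun l _ => ?_
  rw [← e_sub, ← e_nat_mul, ← e_nat_mul, ← e_nat_mul, ← e_add, ← e_add, delta_e, delta_e]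
  ring

theorem ADefined_e (n : ℕ) (a₁ a₂ b₁ b₂ τ : ℂ) :
    ADefined n (e a₁) (e a₂) (e b₁) (e b₂) τ ↔ AddADefined n a₁ a₂ b₁ b₂ τ := by
  have key : ∀ k, k < n →
      ((deltaDefined τ (e a₁ ^ (n - (k + 1) + 1) / e a₂ ^ (k + 1 - 1))
          (e b₁ ^ (k + 1) * e b₂ ^ (n - (k + 1)))
        ∧ deltaDefined τ (e a₂ ^ (k + 1) / e a₁ ^ (n - (k + 1)))
          (e b₁ ^ (k + 1 - 1) * e b₂ ^ (n - (k + 1) + 1))) ↔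
      (DeltaDefined τ (-argP n a₁ a₂ k) (argC n b₁ b₂ (k + 1))
        ∧ DeltaDefined τ (argP n a₁ a₂ (k + 1)) (argC n b₁ b₂ k))) := by
    intro k hk
    have h1 : n - (k + 1) + 1 = n - k := by omega
    rw [h1, Nat.add_sub_cancel, ← e_neg_argP hk.le, ← e_argC hk.le, ← e_argP hk, ← e_argC hk,
      deltaDefined_e, deltaDefined_e]
  constructor
  · intro h k hk
    have hk' := Finset.mem_range.1 hk
    exact (key k hk').1 (h (k + 1) (Finset.mem_Icc.2 (by omega)))
  · intro h k hk
    obtain ⟨j, rfl⟩ : ∃ j, k = j + 1 := ⟨k - 1, by have := Finset.mem_Icc.1 hk; omega⟩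
    have hj : j < n := (Finset.mem_Icc.1 hk).2
    exact (key j hj).2 (h j (Finset.mem_range.2 hj))

theorem BDefined_e (n : ℕ) (a₁ a₂ b₁ b₂ τ : ℂ) :
    BDefined n (e a₁) (e a₂) (e b₁) (e b₂) τ ↔ AddBDefined n a₁ a₂ b₁ b₂ τ := by
  simp only [BDefined, AddBDefined, ← e_add, ← e_nat_mul, deltaDefined_e]

/-- At `a₁ = -a₂ = x` and `b₁ = b₂ = z/n` all `n` summands of `addA` coincide and all weights in
`addB` are `1`. -/
theorem Delta_specialization {n : ℕ} (hn : 0 < n) {x z τ : ℂ} (hτ : 0 < τ.im)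
    (h1 : DeltaDefined τ (n * x) z) (h2 : DeltaDefined τ (-(n * x)) z)
    (h3 : ∀ k ∈ Finset.range n, ∀ l ∈ Finset.range n,
      DeltaDefined τ (((k : ℂ) - (l : ℂ) * τ) / (n : ℂ) + x) z ∧
      DeltaDefined τ ((τ * (l : ℂ) - (k : ℂ)) / (n : ℂ) - x) z) :
    (n : ℂ) * Delta τ (n * x) z * Delta τ (-(n * x)) z =
      1 / (n : ℂ) * ∑ k ∈ Finset.range n, ∑ l ∈ Finset.range n,
        Delta τ (((k : ℂ) - (l : ℂ) * τ) / (n : ℂ) + x) z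
          * Delta τ ((τ * (l : ℂ) - (k : ℂ)) / (n : ℂ) - x) z := by
  have hn0 : (n : ℂ) ≠ 0 := by exact_mod_cast hn.ne'
  have hP : ∀ j, argP n x (-x) j = -(n * x) := fun j => by rw [argP]; ring
  have hC : ∀ j, argC n (z / n) (z / n) j = z := fun j => by rw [argC]; field_simp; ring
  have h := addA_eq_addB (a₁ := x) (a₂ := -x) (b₁ := z / n) (b₂ := z / n) hn hτ
    (fun k _ => by rw [hP, hP, hC, hC, neg_neg]; exact ⟨h1, h2⟩)
    (fun k hk l hl => by
      rw [mul_div_cancel₀ _ hn0, ← sub_eq_add_neg]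
      exact h3 k hk l hl)
  simp only [addA, addB, hP, hC, neg_neg, mul_div_cancel₀ _ hn0, sub_self, mul_zero, e_zero,
    one_mul, ← sub_eq_add_neg, Finset.sum_const, Finset.card_range, nsmul_eq_mul] at h
  rw [← h, mul_assoc]

/-! ### Meromorphy, and density of the common domain of definition. -/

theorem deriv_theta_zero {τ : ℂ} (hτ : 0 < τ.im) :
    deriv (theta τ) 0
      = (1 / I) * (exp ((Real.pi : ℂ) * I * τ / 4) * jacobiTheta₂' ((1 + τ) / 2) τ) := by
  have h0 : jacobiTheta₂ ((1 + τ) / 2) τ = 0 := by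
    have h := theta_zero τ
    rw [theta_eq_jacobi, zero_add, zero_div, e_zero] at h
    simpa [exp_ne_zero] using h
  have h1 : HasDerivAt (fun v : ℂ => jacobiTheta₂ (v + (1 + τ) / 2) τ)
      (jacobiTheta₂' ((1 + τ) / 2) τ) 0 := by
    have := hasDerivAt_jacobiTheta₂_fst (0 + (1 + τ) / 2) hτ
    simpa using this.comp_add_const 0 ((1 + τ) / 2)
  have h2 : DifferentiableAt ℂ (fun v : ℂ => exp ((Real.pi : ℂ) * I * τ / 4) * e (v / 2)) 0 := by
    unfold e
    fun_prop
  have h3 := (h2.hasDerivAt.mul h1).const_mul (1 / I)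
  rw [zero_add, h0, mul_zero, zero_add, zero_div, e_zero, mul_one] at h3
  have h4 : theta τ = fun v => (1 / I) * (exp ((Real.pi : ℂ) * I * τ / 4) * e (v / 2)
      * jacobiTheta₂ (v + (1 + τ) / 2) τ) := funext fun v => theta_eq_jacobi τ v
  rw [h4]
  exact h3.deriv

/-- The numerator of `Δ` contains `θ_τ'(0)`, so its holomorphy in `τ` is needed. On a horizontal
strip around `τ` the series for `jacobiTheta₂'` has a summable majorant. -/
theorem differentiableAt_deriv_theta_zero {τ : ℂ} (hτ : 0 < τ.im) :
    DifferentiableAt ℂ (fun τ => deriv (theta τ) 0) τ := by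
  obtain ⟨T, hT, hTτ⟩ := exists_between hτ
  obtain ⟨S, hS⟩ := exists_gt τ.im
  let U : Set ℂ := {w | T < w.im} ∩ {w | w.im < S}
  have hU : IsOpen U := (isOpen_lt continuous_const continuous_im).inter
    (isOpen_lt continuous_im continuous_const)
  have hJ : DifferentiableOn ℂ (fun w : ℂ => jacobiTheta₂' ((1 + w) / 2) w) U := by
    refine Complex.differentiableOn_tsum_of_summable_norm
      (u := fun n : ℤ => 2 * Real.pi * |n|
        * Real.exp (-Real.pi * (T * n ^ 2 - 2 * S * |n|))) ?_ (fun n => ?_) hU ?_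
    · have := (summable_pow_mul_jacobiTheta₂_term_bound S hT 1).mul_left (2 * Real.pi)
      simpa only [pow_one, ← mul_assoc] using this
    · unfold jacobiTheta₂'_term jacobiTheta₂_term
      fun_prop
    · intro n w hw
      have h1 : T < w.im := hw.1
      have h2 : w.im < S := hw.2
      refine norm_jacobiTheta₂'_term_le hT ?_ h1.le n
      have : ((1 + w) / 2).im = w.im / 2 := by simp
      rw [this, abs_of_pos (by linarith)]
      linarith
  have hU' : U ∈ 𝓝 τ := hU.mem_nhds ⟨hTτ, hS⟩
  have h2 : DifferentiableAt ℂ (fun w : ℂ => (1 / I) * (exp ((Real.pi : ℂ) * I * w / 4)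
      * jacobiTheta₂' ((1 + w) / 2) w)) τ :=
    (DifferentiableAt.mul (by fun_prop) (hJ.differentiableAt hU')).const_mul _
  refine h2.congr_of_eventuallyEq ?_
  filter_upwards [hU'] with w hw
  exact deriv_theta_zero (hT.trans hw.1)

/-- A holomorphic flow on the domain along which no denominator of `A n` and `B n` is constant. -/
noncomputable def flow (s : ℂ) (p : ℂ × ℂ × ℂ × ℂ × ℂ) : ℂ × ℂ × ℂ × ℂ × ℂ :=
  (p.1 * e s, p.2.1 * e (-s), p.2.2.1 * e s, p.2.2.2.1 * e s, p.2.2.2.2)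

theorem tendsto_flow (p : ℂ × ℂ × ℂ × ℂ × ℂ) :
    Tendsto (fun s => flow s p) (𝓝[≠] 0) (𝓝 p) := by
  have ce : Continuous e := differentiable_e.continuous
  have hc : Continuous fun s => flow s p := by
    unfold flow
    fun_prop
  have h := hc.tendsto 0
  have h0 : flow 0 p = p := by simp [flow, e_zero]
  rw [h0] at h
  exact h.mono_left nhdsWithin_le_nhds

/-- `f` is on `V` a quotient of holomorphic functions, whose denominator has isolated zeros along
the flow. -/
def IsQuotientOn (V : Set (ℂ × ℂ × ℂ × ℂ × ℂ)) (f : ℂ × ℂ × ℂ × ℂ × ℂ → ℂ) : Prop :=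
  ∃ g h : ℂ × ℂ × ℂ × ℂ × ℂ → ℂ, DifferentiableOn ℂ g V ∧ DifferentiableOn ℂ h V ∧
    (∀ x ∈ V, ∀ᶠ s in 𝓝[≠] (0 : ℂ), h (flow s x) ≠ 0) ∧ ∀ x ∈ V, h x ≠ 0 → f x = g x / h x

variable {V : Set (ℂ × ℂ × ℂ × ℂ × ℂ)} {f f' : ℂ × ℂ × ℂ × ℂ × ℂ → ℂ}

theorem IsQuotientOn.of_differentiableOn (hf : DifferentiableOn ℂ f V) : IsQuotientOn V f :=
  ⟨f, fun _ => 1, hf, differentiableOn_const _, fun _ _ => by simp, fun _ _ _ => by simp⟩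

/-- Nonvanishing for all small `s ≠ 0` along the flow passes to products of denominators. -/
theorem IsQuotientOn.add (hf : IsQuotientOn V f) (hf' : IsQuotientOn V f') :
    IsQuotientOn V fun x => f x + f' x := by
  obtain ⟨g, h, dg, dh, nz, eq⟩ := hf
  obtain ⟨g', h', dg', dh', nz', eq'⟩ := hf'
  refine ⟨fun x => g x * h' x + h x * g' x, fun x => h x * h' x, (dg.mul dh').add (dh.mul dg'),
    dh.mul dh', fun x hx => ?_, fun x hx hh => ?_⟩
  · filter_upwards [nz x hx, nz' x hx] with s h1 h2 using mul_ne_zero h1 h2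
  · have h1 := left_ne_zero_of_mul hh
    have h2 := right_ne_zero_of_mul hh
    simp only
    rw [eq x hx h1, eq' x hx h2, div_add_div _ _ h1 h2]

theorem IsQuotientOn.mul (hf : IsQuotientOn V f) (hf' : IsQuotientOn V f') :
    IsQuotientOn V fun x => f x * f' x := by
  obtain ⟨g, h, dg, dh, nz, eq⟩ := hf
  obtain ⟨g', h', dg', dh', nz', eq'⟩ := hf'
  refine ⟨fun x => g x * g' x, fun x => h x * h' x, dg.mul dg', dh.mul dh', fun x hx => ?_,
    fun x hx hh => ?_⟩
  · filter_upwards [nz x hx, nz' x hx] with s h1 h2 using mul_ne_zero h1 h2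
  · simp only
    rw [eq x hx (left_ne_zero_of_mul hh), eq' x hx (right_ne_zero_of_mul hh), div_mul_div_comm]

theorem IsQuotientOn.sum {ι : Type*} (S : Finset ι) {F : ι → ℂ × ℂ × ℂ × ℂ × ℂ → ℂ}
    (hF : ∀ i ∈ S, IsQuotientOn V (F i)) : IsQuotientOn V fun x => ∑ i ∈ S, F i x := by
  classical
  induction S using Finset.induction_on with
  | empty => simpa using IsQuotientOn.of_differentiableOn (differentiableOn_const (0 : ℂ))
  | insert i S hi ih =>
    simp only [Finset.sum_insert hi]
    exact (hF i (Finset.mem_insert_self i S)).add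
      (ih fun j hj => hF j (Finset.mem_insert_of_mem hj))

theorem differentiableOn_theta_comp (hV : V ⊆ domain) {l : ℂ × ℂ × ℂ × ℂ × ℂ → ℂ}
    (hl : DifferentiableOn ℂ l V) : DifferentiableOn ℂ (fun x => theta x.2.2.2.2 (l x)) V :=
  fun x hx => (differentiableAt_theta_prod (hV hx).2.2.2.2 (l x)).comp_differentiableWithinAt x
    (f := fun x : ℂ × ℂ × ℂ × ℂ × ℂ => (x.2.2.2.2, l x))
    (DifferentiableWithinAt.prodMk (by fun_prop) (hl x hx))

/-- The exponential of `l` is multiplied by `e (c s)` under the flow. -/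
def IsFlowLinear (V : Set (ℂ × ℂ × ℂ × ℂ × ℂ)) (c : ℂ) (l : ℂ × ℂ × ℂ × ℂ × ℂ → ℂ) : Prop :=
  DifferentiableOn ℂ l V ∧ ∀ x ∈ V, ∀ s, flow s x ∈ V → e (l (flow s x)) = e (l x + c * s)

/-- Linearity of `l` along the flow is known only modulo integers, which suffices for the zeros of
`θ`. -/
theorem IsFlowLinear.eventually_theta_ne_zero (ho : IsOpen V) (hV : V ⊆ domain) {c : ℂ}
    {l : ℂ × ℂ × ℂ × ℂ × ℂ → ℂ} (hl : IsFlowLinear V c l) (hc : c ≠ 0) {x : ℂ × ℂ × ℂ × ℂ × ℂ}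
    (hx : x ∈ V) : ∀ᶠ s in 𝓝[≠] (0 : ℂ), theta x.2.2.2.2 (l (flow s x)) ≠ 0 := by
  filter_upwards [(tendsto_flow x).eventually (ho.mem_nhds hx),
    CyclicTheta.eventually_theta_ne_zero (hV hx).2.2.2.2 (l x) hc] with s h1 h2
  rwa [ne_eq, theta_eq_zero_iff_of_e_eq (hl.2 x hx s h1)]

theorem IsQuotientOn.delta (ho : IsOpen V) (hV : V ⊆ domain) {c d : ℂ}
    {l m : ℂ × ℂ × ℂ × ℂ × ℂ → ℂ} (hl : IsFlowLinear V c l) (hm : IsFlowLinear V d m)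
    (hc : c ≠ 0) (hd : d ≠ 0) : IsQuotientOn V fun x => Delta x.2.2.2.2 (l x) (m x) := by
  refine ⟨fun x => deriv (theta x.2.2.2.2) 0 * theta x.2.2.2.2 (l x + m x),
    fun x => theta x.2.2.2.2 (l x) * theta x.2.2.2.2 (m x),
    DifferentiableOn.mul (fun x hx => ?_) (differentiableOn_theta_comp hV (hl.1.add hm.1)),
    (differentiableOn_theta_comp hV hl.1).mul (differentiableOn_theta_comp hV hm.1),
    fun x hx => ?_, fun x _ _ => rfl⟩
  · exact (differentiableAt_deriv_theta_zero (hV hx).2.2.2.2).comp_differentiableWithinAt x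
      (f := fun x : ℂ × ℂ × ℂ × ℂ × ℂ => x.2.2.2.2) (by fun_prop)
  · filter_upwards [hl.eventually_theta_ne_zero ho hV hc hx,
      hm.eventually_theta_ne_zero ho hV hd hx] with s h1 h2 using mul_ne_zero h1 h2

theorem isMeromorphicOn_of_local
    (h : ∀ p ∈ domain, ∃ V, IsOpen V ∧ p ∈ V ∧ V ⊆ domain ∧ IsQuotientOn V f) :
    IsMeromorphicOn f domain := by
  intro p hp
  obtain ⟨V, ho, hpV, hV, g, h, dg, dh, nz, heq⟩ := h p hp
  refine ⟨V, ho, hpV, hV, g, h, dg, dh, fun x hx => ?_, heq⟩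
  refine mem_closure_of_tendsto (tendsto_flow x) ?_
  filter_upwards [(tendsto_flow x).eventually (ho.mem_nhds hx), nz x hx] with s h1 h2
    using ⟨h1, h2⟩

theorem exists_local_lg {t₀ : ℂ} (ht : t₀ ≠ 0) : ∃ (W : Set ℂ) (l : ℂ → ℂ), IsOpen W ∧ t₀ ∈ W ∧
    DifferentiableOn ℂ l W ∧ ∀ t ∈ W, t ≠ 0 ∧ e (l t) = t := by
  -- Dividing by `t₀` moves the base point to `1`, away from the branch cut.
  refine ⟨{t | t / t₀ ∈ slitPlane}, fun t => lg (t / t₀) + lg t₀,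
    isOpen_slitPlane.preimage (continuous_id.div_const t₀), ?_, fun t ht' => ?_, fun t ht' => ?_⟩
  · change t₀ / t₀ ∈ slitPlane
    rw [div_self ht]
    exact one_mem_slitPlane
  · have h1 : DifferentiableAt ℂ (fun t => log (t / t₀)) t :=
      DifferentiableAt.clog (by fun_prop) ht'
    exact ((h1.div_const _).add_const _).differentiableWithinAt
  · have h1 : t / t₀ ≠ 0 := slitPlane_ne_zero ht'
    refine ⟨fun h => h1 (by rw [h, zero_div]), ?_⟩
    simp only
    rw [e_add, e_lg h1, e_lg ht, div_mul_cancel₀ _ ht]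

/-- Near each point of the domain there are holomorphic logarithms of the variables. -/
theorem exists_local_logs {p : ℂ × ℂ × ℂ × ℂ × ℂ} (hp : p ∈ domain) :
    ∃ (V : Set (ℂ × ℂ × ℂ × ℂ × ℂ)) (a₁ a₂ b₁ b₂ : ℂ × ℂ × ℂ × ℂ × ℂ → ℂ),
      IsOpen V ∧ p ∈ V ∧ V ⊆ domain ∧
      (DifferentiableOn ℂ a₁ V ∧ DifferentiableOn ℂ a₂ V ∧ DifferentiableOn ℂ b₁ V ∧
        DifferentiableOn ℂ b₂ V) ∧
      ∀ x ∈ V, e (a₁ x) = x.1 ∧ e (a₂ x) = x.2.1 ∧ e (b₁ x) = x.2.2.1 ∧ e (b₂ x) = x.2.2.2.1 := by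
  obtain ⟨h1, h2, h3, h4, h5⟩ := hp
  obtain ⟨W₁, l₁, o₁, m₁, d₁, e₁⟩ := exists_local_lg h1
  obtain ⟨W₂, l₂, o₂, m₂, d₂, e₂⟩ := exists_local_lg h2
  obtain ⟨W₃, l₃, o₃, m₃, d₃, e₃⟩ := exists_local_lg h3
  obtain ⟨W₄, l₄, o₄, m₄, d₄, e₄⟩ := exists_local_lg h4
  refine ⟨W₁ ×ˢ W₂ ×ˢ W₃ ×ˢ W₄ ×ˢ {τ : ℂ | 0 < τ.im}, fun x => l₁ x.1, fun x => l₂ x.2.1,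
    fun x => l₃ x.2.2.1, fun x => l₄ x.2.2.2.1,
    o₁.prod (o₂.prod (o₃.prod (o₄.prod (isOpen_lt continuous_const continuous_im)))),
    ⟨m₁, m₂, m₃, m₄, h5⟩,
    fun x hx => ⟨(e₁ _ hx.1).1, (e₂ _ hx.2.1).1, (e₃ _ hx.2.2.1).1, (e₄ _ hx.2.2.2.1).1,
      hx.2.2.2.2⟩, ⟨?_, ?_, ?_, ?_⟩,
    fun x hx => ⟨(e₁ _ hx.1).2, (e₂ _ hx.2.1).2, (e₃ _ hx.2.2.1).2, (e₄ _ hx.2.2.2.1).2⟩⟩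
  · exact d₁.comp (by fun_prop) fun x hx => hx.1
  · exact d₂.comp (by fun_prop) fun x hx => hx.2.1
  · exact d₃.comp (by fun_prop) fun x hx => hx.2.2.1
  · exact d₄.comp (by fun_prop) fun x hx => hx.2.2.2.1

/-- The opposite signs for `a₁` and `a₂` make the slope `-n` for every `j`; equal signs would give
`2j - n`, which can vanish. -/
theorem argP_flow (n j : ℕ) (a₁ a₂ s : ℂ) :
    argP n (a₁ + s) (a₂ + -s) j = argP n a₁ a₂ j + -n * s := by
  simp only [argP]
  ring

theorem argC_flow (n j : ℕ) (b₁ b₂ s : ℂ) :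
    argC n (b₁ + s) (b₂ + s) j = argC n b₁ b₂ j + n * s := by
  simp only [argC]
  ring

/-- Near each point of the domain, `A n` and `B n` are quotients. -/
theorem exists_isQuotientOn {n : ℕ} (hn : 0 < n) {p : ℂ × ℂ × ℂ × ℂ × ℂ} (hp : p ∈ domain) :
    ∃ V, IsOpen V ∧ p ∈ V ∧ V ⊆ domain ∧ IsQuotientOn V (tupled (A n)) ∧
      IsQuotientOn V (tupled (B n)) := by
  obtain ⟨V, a₁, a₂, b₁, b₂, ho, hpV, hV, ⟨da₁, da₂, db₁, db₂⟩, he⟩ := exists_local_logs hp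
  have hn0 : (n : ℂ) ≠ 0 := by exact_mod_cast hn.ne'
  have fa₁ : ∀ x ∈ V, ∀ s, flow s x ∈ V → e (a₁ (flow s x)) = e (a₁ x + s) := fun x hx s hs => by
    rw [(he _ hs).1, e_add, (he x hx).1]; rfl
  have fa₂ : ∀ x ∈ V, ∀ s, flow s x ∈ V → e (a₂ (flow s x)) = e (a₂ x + -s) := fun x hx s hs => by
    rw [(he _ hs).2.1, e_add, (he x hx).2.1]; rfl
  have fb₁ : ∀ x ∈ V, ∀ s, flow s x ∈ V → e (b₁ (flow s x)) = e (b₁ x + s) := fun x hx s hs => by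
    rw [(he _ hs).2.2.1, e_add, (he x hx).2.2.1]; rfl
  have fb₂ : ∀ x ∈ V, ∀ s, flow s x ∈ V → e (b₂ (flow s x)) = e (b₂ x + s) := fun x hx s hs => by
    rw [(he _ hs).2.2.2, e_add, (he x hx).2.2.2]; rfl
  have lP : ∀ j, j ≤ n → IsFlowLinear V (-n) fun x => argP n (a₁ x) (a₂ x) j := fun j hj =>
    ⟨(da₂.const_mul _).sub (da₁.const_mul _), fun x hx s hs => by
      rw [← argP_flow, e_argP hj, e_argP hj, fa₁ x hx s hs, fa₂ x hx s hs]⟩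
  have lP' : ∀ j, j ≤ n → IsFlowLinear V n fun x => -argP n (a₁ x) (a₂ x) j := fun j hj =>
    ⟨(lP j hj).1.neg, fun x hx s hs => by
      rw [e_neg, (lP j hj).2 x hx s hs, ← e_neg]
      ring_nf⟩
  have lC : ∀ j, j ≤ n → IsFlowLinear V n fun x => argC n (b₁ x) (b₂ x) j := fun j hj =>
    ⟨(db₁.const_mul _).add (db₂.const_mul _), fun x hx s hs => by
      rw [← argC_flow, e_argC hj, e_argC hj, fb₁ x hx s hs, fb₂ x hx s hs]⟩
  have l₁ : ∀ k l : ℕ, IsFlowLinear V 1 fun x =>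
      ((k : ℂ) - (l : ℂ) * x.2.2.2.2) / (n : ℂ) + a₁ x := fun k l =>
    ⟨DifferentiableOn.add (by fun_prop) da₁, fun x hx s hs => by
      rw [e_add, fa₁ x hx s hs, ← e_add, one_mul, ← add_assoc]; rfl⟩
  have l₂ : ∀ k l : ℕ, IsFlowLinear V (-1) fun x =>
      (x.2.2.2.2 * (l : ℂ) - (k : ℂ)) / (n : ℂ) + a₂ x := fun k l =>
    ⟨DifferentiableOn.add (by fun_prop) da₂, fun x hx s hs => by
      rw [e_add, fa₂ x hx s hs, ← e_add, neg_one_mul, ← add_assoc]; rfl⟩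
  have m₁ : IsFlowLinear V n fun x => n * b₁ x := ⟨db₁.const_mul _, fun x hx s hs => by
    rw [e_nat_mul, fb₁ x hx s hs, ← e_nat_mul, mul_add]⟩
  have m₂ : IsFlowLinear V n fun x => n * b₂ x := ⟨db₂.const_mul _, fun x hx s hs => by
    rw [e_nat_mul, fb₂ x hx s hs, ← e_nat_mul, mul_add]⟩
  have hcong : ∀ {f g : ℂ × ℂ × ℂ × ℂ × ℂ → ℂ}, (∀ x ∈ V, f x = g x) → IsQuotientOn V g →
      IsQuotientOn V f := by
    rintro f g hfg ⟨g', h, dg, dh, nz, heq⟩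
    exact ⟨g', h, dg, dh, nz, fun x hx hh => (hfg x hx).trans (heq x hx hh)⟩
  have hconst : ∀ c : ℂ, IsQuotientOn V fun _ => c := fun c =>
    IsQuotientOn.of_differentiableOn (differentiableOn_const c)
  refine ⟨V, ho, hpV, hV, ?_, ?_⟩
  · refine hcong (g := fun x => addA n (a₁ x) (a₂ x) (b₁ x) (b₂ x) x.2.2.2.2
      * (1 / (2 * (Real.pi : ℂ) * I)) ^ 2) (fun x hx => ?_) ?_
    · obtain ⟨h1, h2, h3, h4⟩ := he x hx
      rw [← A_e, h1, h2, h3, h4, tupled]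
    · refine IsQuotientOn.mul (IsQuotientOn.sum _ fun k hk => ?_) (hconst _)
      have hk' : k < n := Finset.mem_range.1 hk
      exact (IsQuotientOn.delta ho hV (lP' k hk'.le) (lC (k + 1) hk') hn0 hn0).mul
        (IsQuotientOn.delta ho hV (lP (k + 1) hk') (lC k hk'.le) (neg_ne_zero.2 hn0) hn0)
  · refine hcong (g := fun x => addB n (a₁ x) (a₂ x) (b₁ x) (b₂ x) x.2.2.2.2
      * (1 / (2 * (Real.pi : ℂ) * I)) ^ 2) (fun x hx => ?_) ?_
    · obtain ⟨h1, h2, h3, h4⟩ := he x hx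
      rw [← B_e, h1, h2, h3, h4, tupled]
    · refine IsQuotientOn.mul (IsQuotientOn.mul (hconst _) (IsQuotientOn.sum _ fun k _ =>
        IsQuotientOn.sum _ fun l _ => ?_)) (hconst _)
      refine (IsQuotientOn.mul (IsQuotientOn.of_differentiableOn ?_)
        (IsQuotientOn.delta ho hV (l₁ k l) m₁ one_ne_zero hn0)).mul
        (IsQuotientOn.delta ho hV (l₂ k l) m₂ (neg_ne_zero.2 one_ne_zero) hn0)
      exact differentiable_e.comp_differentiableOn ((db₂.sub db₁).const_mul _)

/-- Along the flow each of the finitely many denominators is a theta function of an argument with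
nonzero slope in `s`, so all are nonzero for small `s ≠ 0`. -/
theorem domain_subset_closure_defined {n : ℕ} (hn : 0 < n) :
    domain ⊆ closure {p ∈ domain |
      ADefined n p.1 p.2.1 p.2.2.1 p.2.2.2.1 p.2.2.2.2 ∧
      BDefined n p.1 p.2.1 p.2.2.1 p.2.2.2.1 p.2.2.2.2} := by
  rintro ⟨t₁, t₂, μ₁, μ₂, τ⟩ ⟨h1, h2, h3, h4, h5⟩
  dsimp only at h1 h2 h3 h4 h5
  have hn0 : (n : ℂ) ≠ 0 := by exact_mod_cast hn.ne'
  obtain ⟨a₁, rfl⟩ : ∃ a, e a = t₁ := ⟨_, e_lg h1⟩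
  obtain ⟨a₂, rfl⟩ : ∃ a, e a = t₂ := ⟨_, e_lg h2⟩
  obtain ⟨b₁, rfl⟩ : ∃ a, e a = μ₁ := ⟨_, e_lg h3⟩
  obtain ⟨b₂, rfl⟩ : ∃ a, e a = μ₂ := ⟨_, e_lg h4⟩
  refine mem_closure_of_tendsto (tendsto_flow _) ?_
  have hA : ∀ᶠ s in 𝓝[≠] (0 : ℂ), AddADefined n (a₁ + s) (a₂ + -s) (b₁ + s) (b₂ + s) τ := by
    refine (Filter.eventually_all_finset _).2 fun k hk => ?_
    filter_upwards [eventually_theta_ne_zero h5 (argP n a₁ a₂ k) (neg_ne_zero.2 hn0),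
      eventually_theta_ne_zero h5 (argP n a₁ a₂ (k + 1)) (neg_ne_zero.2 hn0),
      eventually_theta_ne_zero h5 (argC n b₁ b₂ k) hn0,
      eventually_theta_ne_zero h5 (argC n b₁ b₂ (k + 1)) hn0] with s g1 g2 g3 g4
    simp only [argP_flow, argC_flow, DeltaDefined, theta_neg, neg_ne_zero]
    exact ⟨⟨g1, g4⟩, g2, g3⟩
  have hB : ∀ᶠ s in 𝓝[≠] (0 : ℂ), AddBDefined n (a₁ + s) (a₂ + -s) (b₁ + s) (b₂ + s) τ := by
    refine (Filter.eventually_all_finset _).2 fun k hk =>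
      (Filter.eventually_all_finset _).2 fun l hl => ?_
    filter_upwards [eventually_theta_ne_zero h5 (((k : ℂ) - (l : ℂ) * τ) / (n : ℂ) + a₁) one_ne_zero,
      eventually_theta_ne_zero h5 ((τ * (l : ℂ) - (k : ℂ)) / (n : ℂ) + a₂)
        (neg_ne_zero.2 one_ne_zero),
      eventually_theta_ne_zero h5 (n * b₁) hn0,
      eventually_theta_ne_zero h5 (n * b₂) hn0] with s g1 g2 g3 g4
    rw [one_mul] at g1
    rw [neg_one_mul] at g2
    simp only [DeltaDefined, mul_add, ← add_assoc]
    exact ⟨⟨g1, g3⟩, g2, g4⟩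
  filter_upwards [hA, hB] with s g1 g2
  simp only [flow, ← e_add]
  refine ⟨⟨e_ne_zero _, e_ne_zero _, e_ne_zero _, e_ne_zero _, h5⟩, ?_, ?_⟩
  · exact (ADefined_e n _ _ _ _ τ).2 g1
  · exact (BDefined_e n _ _ _ _ τ).2 g2

end CyclicTheta

theorem theorem2p1 (n : ℕ) (hn : 0 < n) :
    -- both sides are meromorphic functions of `(t₁, t₂, μ₁, μ₂, τ)`
    CyclicTheta.IsMeromorphicOn (CyclicTheta.tupled (CyclicTheta.A n)) CyclicTheta.domain ∧
    CyclicTheta.IsMeromorphicOn (CyclicTheta.tupled (CyclicTheta.B n)) CyclicTheta.domain ∧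
    -- all the summands are defined on a dense set of points
    CyclicTheta.domain ⊆ closure {p ∈ CyclicTheta.domain |
      CyclicTheta.ADefined n p.1 p.2.1 p.2.2.1 p.2.2.2.1 p.2.2.2.2 ∧
      CyclicTheta.BDefined n p.1 p.2.1 p.2.2.1 p.2.2.2.1 p.2.2.2.2} ∧
    -- the two sides are equal wherever all the summands are defined
    (∀ t₁ t₂ μ₁ μ₂ τ : ℂ, t₁ ≠ 0 → t₂ ≠ 0 → μ₁ ≠ 0 → μ₂ ≠ 0 → 0 < τ.im →
      CyclicTheta.ADefined n t₁ t₂ μ₁ μ₂ τ → CyclicTheta.BDefined n t₁ t₂ μ₁ μ₂ τ →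
      CyclicTheta.A n t₁ t₂ μ₁ μ₂ τ = CyclicTheta.B n t₁ t₂ μ₁ μ₂ τ) ∧
    -- the specialization, in additive variables
    (∀ x z τ : ℂ, 0 < τ.im →
      CyclicTheta.DeltaDefined τ ((n : ℂ) * x) z → CyclicTheta.DeltaDefined τ (-((n : ℂ) * x)) z →
      (∀ k ∈ Finset.range n, ∀ l ∈ Finset.range n,
        CyclicTheta.DeltaDefined τ (((k : ℂ) - (l : ℂ) * τ) / (n : ℂ) + x) z ∧
        CyclicTheta.DeltaDefined τ ((τ * (l : ℂ) - (k : ℂ)) / (n : ℂ) - x) z) →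
      (n : ℂ) * CyclicTheta.Delta τ ((n : ℂ) * x) z * CyclicTheta.Delta τ (-((n : ℂ) * x)) z =
        1 / (n : ℂ) * ∑ k ∈ Finset.range n, ∑ l ∈ Finset.range n,
          CyclicTheta.Delta τ (((k : ℂ) - (l : ℂ) * τ) / (n : ℂ) + x) z
            * CyclicTheta.Delta τ ((τ * (l : ℂ) - (k : ℂ)) / (n : ℂ) - x) z) := by
  refine ⟨?_, ?_, CyclicTheta.domain_subset_closure_defined hn, ?_, ?_⟩
  · refine CyclicTheta.isMeromorphicOn_of_local fun p hp => ?_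
    obtain ⟨V, h1, h2, h3, h4, -⟩ := CyclicTheta.exists_isQuotientOn hn hp
    exact ⟨V, h1, h2, h3, h4⟩
  · refine CyclicTheta.isMeromorphicOn_of_local fun p hp => ?_
    obtain ⟨V, h1, h2, h3, -, h4⟩ := CyclicTheta.exists_isQuotientOn hn hp
    exact ⟨V, h1, h2, h3, h4⟩
  · intro t₁ t₂ μ₁ μ₂ τ h1 h2 h3 h4 hτ hA hB
    obtain ⟨a₁, rfl⟩ : ∃ a, CyclicTheta.e a = t₁ := ⟨_, CyclicTheta.e_lg h1⟩
    obtain ⟨a₂, rfl⟩ : ∃ a, CyclicTheta.e a = t₂ := ⟨_, CyclicTheta.e_lg h2⟩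
    obtain ⟨b₁, rfl⟩ : ∃ a, CyclicTheta.e a = μ₁ := ⟨_, CyclicTheta.e_lg h3⟩
    obtain ⟨b₂, rfl⟩ : ∃ a, CyclicTheta.e a = μ₂ := ⟨_, CyclicTheta.e_lg h4⟩
    rw [CyclicTheta.ADefined_e] at hA
    rw [CyclicTheta.BDefined_e] at hB
    rw [CyclicTheta.A_e, CyclicTheta.B_e, CyclicTheta.addA_eq_addB hn hτ hA hB]
  · intro x z τ hτ h1 h2 h3
    exact CyclicTheta.Delta_specialization hn hτ h1 h2 h3
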